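/- **Model.** Let $(\Omega,\mathcal F,\mathsf P)$ be a probability space, $\{X^0_k\}_{k\ge0}$ and $\{X^1_k\}_{k\ge0}$ two i.i.d. sequences with values in a measurable space $\mathsf Y$, and $\tau_a$ a change time with values in $\{0,1,2,\dots\}\cup\{\infty\}$, independent of $\{X^0_k\}$ and independent of $\{X^1_k\}$. The observations are $Y_k=X^0_k$ for $k<\tau_a$ and $Y_k=X^1_k$ for $k\ge\tau_a$. Let $F\colon\mathsf Y\to\mathbb R$ be measurable (not necessarily a log likelihood ratio) with $m_i=\mathsf E[F(X^i_0)]$, $m_0<0<m_1$. The CUSUM statistic is $\mathcal X_0=0$, $\mathcal X_{n+1}=\max\{0,\mathcal X_n+F(Y_{n+1})\}$, and for a threshold $h\ge0$ the CUSUM test stops at $\tau_s(h)=\min\{n\ge0:\mathcal X_n\ge h\}$. Put $$\mathrm{MDD}(h)=\mathsf E[(\tau_s(h)-\tau_a)_+],\qquad \mathrm{MDE}(h)=\mathsf E[(\tau_s(h)-\tau_a)_-],\qquad J(h,\kappa)=\mathrm{MDD}(h)+\kappa\,\mathrm{MDE}(h),$$ with $x_+=\max(0,x)$ and $x_-=\max(0,-x)$,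 and $J^*(\kappa)=\inf_{h\ge0}J(h,\kappa)$. Let $\Lambda_i(\upsilon)=\log\mathsf E[\exp(\upsilon F(X^i_0))]\in(-\infty,\infty]$ for $\upsilon\in\mathbb R$. **Proposition.** Suppose that 1. there is $\varrho_a\in(0,\infty)$ with $\lim_{n\to\infty}\frac1n\log\mathsf P\{\tau_a\ge n\}=-\varrho_a$; 2. $\Lambda_0$ has exactly two roots $0$ and $\upsilon_0\ne0$, there is a unique solution $\upsilon_+>\upsilon_0$ of $\Lambda_0(\upsilon_+)=\varrho_a$, and $\Lambda_0$ is finite on a neighborhood of $[0,\upsilon_+]$; 3. $\Lambda_1$ is finite on a neighborhood of $0$. Then there are functions $\varepsilon_1,\varepsilon_2$ of the threshold alone, with $\varepsilon_1(h)\to0$ and $\varepsilon_2(h)\to0$ as $h\to\infty$, such that for all $h>0$ and $\kappa>0$ the cost $J(h,\kappa)$ is finite and $$J(h,\kappa)=h\Bigl[\frac1{m_1}+\varepsilon_1(h)\Bigr]+\kappa\exp\bigl(-h[\upsilon_++\varepsilon_2(h)]\bigr).$$ Consequently, as $\kappa\to\infty$, the following hold. * Optimal threshold: if $h^*(\kappa)\in\arg\min_{h\ge0}J(h,\kappa)$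 for all large $\kappa$, then $h^*(\kappa)=\frac1{\upsilon_+}\log\kappa+o(\log\kappa)$. The same holds, for each fixed $\delta>0$, if only $h^*(\kappa)\ge0$ and $J(h^*(\kappa),\kappa)\le J^*(\kappa)+\delta$ for all large $\kappa$ (such thresholds exist even where the minimum is not attained). * Optimal cost: $J^*(\kappa)$ is finite for all large $\kappa$, and $J^*(\kappa)=\frac1{m_1\upsilon_+}\log\kappa+o(\log\kappa)$. -/

import Mathlib

open MeasureTheory ProbabilityTheory Filter Topology Asymptotics
open scoped ENNReal

namespace QCD

/-- The observations: the pre-change sequence strictly before the change time `τ`, and the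
post-change sequence from time `τ` on. -/
def observation {S : Type*} (x₀ x₁ : ℕ → S) (τ : ℕ∞) (k : ℕ) : S :=
  if (k : ℕ∞) < τ then x₀ k else x₁ k

/-- The CUSUM statistic driven by `F`: it starts at `0`, and its value at time `n + 1` is
`max (0, value at n + F (y (n + 1)))`. -/
def cusum {S : Type*} (F : S → ℝ) (y : ℕ → S) : ℕ → ℝ
  | 0 => 0
  | n + 1 => max 0 (cusum F y n + F (y (n + 1)))

/-- The stopping time `min {n ≥ 0 : cusum n ≥ h}`, equal to `⊤` if `h` is never reached. -/
noncomputable def alarmTime {S : Type*} (F : S → ℝ) (y : ℕ → S) (h : ℝ) : ℕ∞ :=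
  ⨅ (n : ℕ) (_ : h ≤ cusum F y n), (n : ℕ∞)

section Costs

variable {Ω S : Type*} [MeasurableSpace Ω]

/-- The CUSUM stopping time with threshold `h` as a random variable in the change-point model. -/
noncomputable def alarm (X₀ X₁ : ℕ → Ω → S) (τ : Ω → ℕ∞) (F : S → ℝ) (h : ℝ) (ω : Ω) : ℕ∞ :=
  alarmTime F (observation (fun k => X₀ k ω) (fun k => X₁ k ω) (τ ω)) h

/-- Mean detection delay, the expectation of the positive part of (alarm time - change time).
The subtraction of `ℕ∞` is truncated at `0`, so it is the positive part. -/
noncomputable def MDD (P : Measure Ω) (X₀ X₁ : ℕ → Ω → S) (τ : Ω → ℕ∞) (F : S → ℝ) (h : ℝ) :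
    ℝ≥0∞ :=
  ∫⁻ ω, ((alarm X₀ X₁ τ F h ω - τ ω : ℕ∞) : ℝ≥0∞) ∂P

/-- Mean detection eagerness, the expectation of the negative part of
(alarm time - change time). -/
noncomputable def MDE (P : Measure Ω) (X₀ X₁ : ℕ → Ω → S) (τ : Ω → ℕ∞) (F : S → ℝ) (h : ℝ) :
    ℝ≥0∞ :=
  ∫⁻ ω, ((τ ω - alarm X₀ X₁ τ F h ω : ℕ∞) : ℝ≥0∞) ∂P

/-- The cost `MDD + κ * MDE` of the CUSUM test with threshold `h`. -/
noncomputable def cost (P : Measure Ω) (X₀ X₁ : ℕ → Ω → S) (τ : Ω → ℕ∞) (F : S → ℝ)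
    (h κ : ℝ) : ℝ≥0∞ :=
  MDD P X₀ X₁ τ F h + ENNReal.ofReal κ * MDE P X₀ X₁ τ F h

/-- The optimal cost over all thresholds `h ≥ 0`. -/
noncomputable def optCost (P : Measure Ω) (X₀ X₁ : ℕ → Ω → S) (τ : Ω → ℕ∞) (F : S → ℝ)
    (κ : ℝ) : ℝ≥0∞ :=
  ⨅ (h : ℝ) (_ : 0 ≤ h), cost P X₀ X₁ τ F h κ

/-- The set of optimal thresholds (the `arg min` of the cost over `h ≥ 0`). -/
def optThresholds (P : Measure Ω) (X₀ X₁ : ℕ → Ω → S) (τ : Ω → ℕ∞) (F : S → ℝ)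
    (κ : ℝ) : Set ℝ :=
  {h | 0 ≤ h ∧ ∀ h' : ℝ, 0 ≤ h' → cost P X₀ X₁ τ F h κ ≤ cost P X₀ X₁ τ F h' κ}

/-- Thresholds `h ≥ 0` whose cost is within `δ` of the optimal cost. -/
def nearOptThresholds (P : Measure Ω) (X₀ X₁ : ℕ → Ω → S) (τ : Ω → ℕ∞) (F : S → ℝ)
    (δ κ : ℝ) : Set ℝ :=
  {h | 0 ≤ h ∧ cost P X₀ X₁ τ F h κ ≤ optCost P X₀ X₁ τ F κ + ENNReal.ofReal δ}

/-- The log moment generating function `υ ↦ log E[exp (υ Z)]`, with values in the extended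
reals (it is `⊤` where the expectation is infinite). -/
noncomputable def logMGF (P : Measure Ω) (Z : Ω → ℝ) (υ : ℝ) : EReal :=
  ENNReal.log (∫⁻ ω, ENNReal.ofReal (Real.exp (υ * Z ω)) ∂P)

/-- Regular geometric tail with rate `ϱ`:
`(1 / n) log P{τ ≥ n}` tends to `-ϱ` as `n → ∞`. -/
def RegularGeometricTail (P : Measure Ω) (τ : Ω → ℕ∞) (ϱ : ℝ) : Prop :=
  Tendsto (fun n : ℕ => ((1 / (n : ℝ) : ℝ) : EReal) * ENNReal.log (P {ω | (n : ℕ∞) ≤ τ ω}))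
    atTop (𝓝 ((-ϱ : ℝ) : EReal))

end Costs

end QCD

/-! The two parts of the cost are estimated separately, and only then traded off.

Eagerness. Until the change the test sees only `X₀`, so by independence MDE(h) is the sum over n of
P(alarm of `X₀` ≤ n) P(τ > n). The CUSUM statistic is always a sum over a window of increments, so
by Chernoff the first factor is at most (n+1)² e^(-vh) max(M(v), 1)^n, with M the pre-change moment
generating function. The second decays like e^(-ϱn), and the series converges once M(v) < e^ϱ.
Convexity of M gives this for all v in (υ₀, υ₊) (`exists_MDE_le`). Conversely, let a > 0 be the mean
increment under tilting by υ₊. The single term n ≈ h/a is already about e^(-υ₊h) M(υ₊)^n e^(-ϱn) =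
e^(-υ₊h), because M(υ₊) = e^ϱ (`exists_le_MDE`).

Delay. After the change the statistic dominates the walk of post-change increments, and a Chernoff
bound for that walk gives MDD(h) ≤ h(1/m₁ + ε) + K (`exists_MDD_le`). By the strong law the
statistic grows no faster than any rate above m₁, which gives the matching lower bound
(`exists_le_MDD`).

Trade-off. With L = log κ, a threshold slightly above L/υ₊ keeps κ MDE bounded and costs about
L/(m₁υ₊) in delay. A threshold below (1/υ₊ - ε)L makes κ MDE exponentially large in L. -/

namespace QCD

/-! ### Pathwise properties of the CUSUM recursion -/

section Deterministic

variable {S : Type*} {F : S → ℝ} {y y' : ℕ → S} {h : ℝ}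

theorem alarmTime_le_iff {n : ℕ} :
    alarmTime F y h ≤ n ↔ ∃ m ≤ n, h ≤ cusum F y m := by
  constructor
  · intro H
    by_contra! hc
    have : ((n + 1 : ℕ) : ℕ∞) ≤ alarmTime F y h := by
      refine le_iInf₂ fun m hm => ?_
      by_contra! hlt
      exact absurd (hc m (by have := Nat.cast_lt.1 hlt; omega)) (not_lt.2 hm)
    have := Nat.cast_le.1 (this.trans H)
    omega
  · rintro ⟨m, hmn, hm⟩
    exact iInf₂_le_of_le m hm (Nat.cast_le.2 hmn)

theorem natCast_lt_alarmTime_iff {n : ℕ} :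
    (n : ℕ∞) < alarmTime F y h ↔ ∀ m ≤ n, cusum F y m < h := by
  rw [← not_le, alarmTime_le_iff]
  push Not
  rfl

/-- The statistic is nonnegative at time `k`, and the maximum with zero can only raise it
afterwards. -/
theorem sum_le_cusum_add (F : S → ℝ) (y : ℕ → S) (k n : ℕ) :
    ∑ j ∈ Finset.range n, F (y (k + 1 + j)) ≤ cusum F y (k + n) := by
  induction n with
  | zero =>
    cases k with
    | zero => simp [cusum]
    | succ k => simp [cusum]
  | succ n ih =>
    rw [Finset.sum_range_succ, ← add_assoc, cusum, show k + 1 + n = k + n + 1 by omega]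
    exact (add_le_add_left ih _).trans (le_max_right _ _)

/-- Shifted up by `c`, the walk is nonnegative and has the same increments, so it stays above the
reflected walk. -/
theorem cusum_le_sum_add {c : ℝ}
    (hc : ∀ n, -c ≤ ∑ j ∈ Finset.range n, F (y (j + 1))) (n : ℕ) :
    cusum F y n ≤ ∑ j ∈ Finset.range n, F (y (j + 1)) + c := by
  induction n with
  | zero => simpa [cusum] using hc 0
  | succ n ih =>
    rw [cusum]
    have := hc (n + 1)
    rw [Finset.sum_range_succ] at this ⊢
    exact max_le (by linarith) (by linarith)

/-- The window starts at the last time the maximum reset the statistic to zero. -/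
theorem exists_cusum_eq_sum (F : S → ℝ) (y : ℕ → S) (n : ℕ) :
    ∃ a ≤ n, cusum F y n = ∑ j ∈ Finset.Ico a n, F (y (j + 1)) := by
  induction n with
  | zero => exact ⟨0, le_rfl, by simp [cusum]⟩
  | succ n ih =>
    obtain ⟨a, ha, he⟩ := ih
    rcases le_total (cusum F y n + F (y (n + 1))) 0 with h0 | h0
    · exact ⟨n + 1, le_rfl, by simp [cusum, h0]⟩
    · refine ⟨a, by omega, ?_⟩
      rw [cusum, max_eq_right h0, Finset.sum_Ico_succ_top ha, he]

theorem cusum_congr {n : ℕ} (hyy' : ∀ m ≤ n, y m = y' m) : cusum F y n = cusum F y' n := by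
  induction n with
  | zero => rfl
  | succ n ih => rw [cusum, cusum, ih fun m hm => hyy' m (by omega), hyy' _ le_rfl]

theorem observation_eq_pre {x₀ x₁ : ℕ → S} {τ : ℕ∞} {k : ℕ} (hk : (k : ℕ∞) < τ) :
    observation x₀ x₁ τ k = x₀ k := if_pos hk

theorem observation_eq_post {x₀ x₁ : ℕ → S} {τ : ℕ∞} {k : ℕ} (hk : τ ≤ k) :
    observation x₀ x₁ τ k = x₁ k := if_neg (not_lt.2 hk)

theorem alarmTime_observation_le_and_lt_iff {x₀ x₁ : ℕ → S} {τ : ℕ∞} {n : ℕ} :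
    (alarmTime F (observation x₀ x₁ τ) h ≤ n ∧ (n : ℕ∞) < τ) ↔
      (alarmTime F x₀ h ≤ n ∧ (n : ℕ∞) < τ) := by
  refine and_congr_left fun hn => ?_
  rw [alarmTime_le_iff, alarmTime_le_iff]
  refine exists_congr fun m => and_congr_right fun hm => ?_
  rw [cusum_congr fun k hk => observation_eq_pre (lt_of_le_of_lt (Nat.cast_le.2 (hk.trans hm)) hn)]

theorem sum_lt_of_add_lt_alarmTime_observation {x₀ x₁ : ℕ → S} {k n : ℕ}
    (hlt : ((k + n : ℕ) : ℕ∞) < alarmTime F (observation x₀ x₁ k) h) :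
    ∑ j ∈ Finset.range n, F (x₁ (k + 1 + j)) < h := by
  refine lt_of_eq_of_lt ?_ ((sum_le_cusum_add F (observation x₀ x₁ k) k n).trans_lt
    (natCast_lt_alarmTime_iff.1 hlt _ le_rfl))
  refine Finset.sum_congr rfl fun j _ => ?_
  rw [observation_eq_post (Nat.cast_le.2 (by omega))]

/-- If the averages of the increments converge to `m ≥ 0`, the CUSUM statistic has at most linear
growth with any rate above `m`. -/
theorem exists_cusum_le {m r : ℝ} (hm : 0 < m) (hr : m < r)
    (hlim : Tendsto (fun n : ℕ => (∑ j ∈ Finset.range n, F (y (j + 1))) / n) atTop (𝓝 m)) :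
    ∃ c : ℝ, ∀ n, cusum F y n ≤ c + r * n := by
  set T : ℕ → ℝ := fun n => ∑ j ∈ Finset.range n, F (y (j + 1)) with hT
  have h1 : ∀ᶠ n : ℕ in atTop, 0 ≤ T n ∧ T n ≤ r * n := by
    filter_upwards [hlim.eventually (lt_mem_nhds hm), hlim.eventually (gt_mem_nhds hr),
      eventually_gt_atTop 0] with n h0 h2 hn
    have hn' : (0 : ℝ) < n := Nat.cast_pos.2 hn
    exact ⟨((div_pos_iff_of_pos_right hn').1 h0).le, ((div_lt_iff₀ hn').1 h2).le⟩
  obtain ⟨N, hN⟩ := eventually_atTop.1 h1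
  -- `B` absorbs the finitely many times before `N`. It is used twice, once for the lower and once
  -- for the upper bound on the partial sums.
  set B : ℝ := ∑ j ∈ Finset.range N, |T j| with hB
  have hB0 : 0 ≤ B := Finset.sum_nonneg fun _ _ => abs_nonneg _
  have hTB : ∀ n < N, |T n| ≤ B := fun n hn =>
    Finset.single_le_sum (f := fun j => |T j|) (fun _ _ => abs_nonneg _) (Finset.mem_range.2 hn)
  have hlow : ∀ n, -B ≤ T n := fun n => by
    rcases lt_or_ge n N with hn | hn
    · linarith [neg_abs_le (T n), hTB n hn]
    · linarith [(hN n hn).1]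
  have hup : ∀ n, T n ≤ B + r * n := fun n => by
    have hrn : 0 ≤ r * n := mul_nonneg (hm.trans hr).le (Nat.cast_nonneg _)
    rcases lt_or_ge n N with hn | hn
    · linarith [le_abs_self (T n), hTB n hn]
    · linarith [(hN n hn).2]
  refine ⟨B + B, fun n => (cusum_le_sum_add hlow n).trans ?_⟩
  linarith [hup n]

end Deterministic

/-! ### Extended naturals as sums of indicators -/

theorem _root_.ENat.toENNReal_eq_tsum (a : ℕ∞) :
    (a : ℝ≥0∞) = ∑' n : ℕ, {n : ℕ | (n : ℕ∞) < a}.indicator 1 n := by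
  rw [← tsum_subtype {n : ℕ | (n : ℕ∞) < a} (1 : ℕ → ℝ≥0∞)]
  simp only [Pi.one_apply, ENNReal.tsum_set_one]
  congr 1
  induction a with
  | top => simp [Set.encard_univ]
  | coe a =>
    simp only [Nat.cast_lt]
    rw [show {n | n < a} = ((Finset.range a : Finset ℕ) : Set ℕ) by ext; simp,
      Set.encard_coe_eq_coe_finsetCard, Finset.card_range]

theorem _root_.ENat.toENNReal_sub_eq_tsum (a b : ℕ∞) :
    ((b - a : ℕ∞) : ℝ≥0∞) = ∑' n : ℕ, {n : ℕ | a ≤ n ∧ (n : ℕ∞) < b}.indicator 1 n := by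
  induction a with
  | top => simp
  | coe a =>
    rw [ENat.toENNReal_eq_tsum, ← tsum_subtype, ← tsum_subtype]
    simp only [Pi.one_apply, ENNReal.tsum_set_one]
    congr 1
    rw [← (add_right_injective a).encard_image]
    congr 1
    ext n
    simp only [Set.mem_image, Set.mem_ofPred_eq, Nat.cast_le]
    constructor
    · rintro ⟨m, hm, rfl⟩
      exact ⟨by omega, by push_cast; exact lt_tsub_iff_left.1 hm⟩
    · rintro ⟨han, hn⟩
      obtain ⟨m, rfl⟩ := Nat.exists_eq_add_of_le han
      exact ⟨m, lt_tsub_iff_left.2 (by exact_mod_cast hn), rfl⟩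

theorem _root_.ENat.measurable_of_le {α : Type*} [MeasurableSpace α] {f : α → ℕ∞}
    (hf : ∀ n : ℕ, MeasurableSet {a | f a ≤ n}) : Measurable f := by
  refine ENat.measurable_iff.2 fun n => ?_
  have : f ⁻¹' {(n : ℕ∞)} = {a | f a ≤ n} \ ⋃ m ∈ Finset.range n, {a | f a ≤ m} := by
    ext a
    simp only [Set.mem_preimage, Set.mem_singleton_iff, Set.mem_sdiff, Set.mem_ofPred_eq,
      Set.mem_iUnion, Finset.mem_range, not_exists, not_le]
    constructor
    · intro h
      rw [h]
      exact ⟨le_rfl, fun m hm => Nat.cast_lt.2 hm⟩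
    · rintro ⟨h1, h2⟩
      obtain ⟨k, hk⟩ := ENat.ne_top_iff_exists.1 (ne_top_of_le_ne_top (ENat.natCast_ne_top n) h1)
      rw [← hk] at h1 h2 ⊢
      by_contra hne
      have hkn : k < n := lt_of_le_of_ne (Nat.cast_le.1 h1) fun h => hne (by rw [h])
      exact lt_irrefl _ (h2 k hkn)
  rw [this]
  exact (hf n).diff (Finset.measurableSet_biUnion _ fun m _ => hf m)

/-! ### Measurability of the alarm time -/

section Measurability

variable {Ω S : Type*} [MeasurableSpace Ω] [MeasurableSpace S] {F : S → ℝ}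

theorem measurable_cusum (hF : Measurable F) {Y : Ω → ℕ → S} (hY : ∀ k, Measurable fun ω => Y ω k)
    (n : ℕ) : Measurable fun ω => cusum F (Y ω) n := by
  induction n with
  | zero => exact measurable_const
  | succ n ih => exact measurable_const.max (ih.add (hF.comp (hY _)))

theorem measurable_alarmTime (hF : Measurable F) {Y : Ω → ℕ → S}
    (hY : ∀ k, Measurable fun ω => Y ω k) (h : ℝ) :
    Measurable fun ω => alarmTime F (Y ω) h := by
  refine ENat.measurable_of_le fun n => ?_
  simp only [alarmTime_le_iff, ← exists_prop]
  have : {ω | ∃ m, ∃ _ : m ≤ n, h ≤ cusum F (Y ω) m} =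
      ⋃ m, ⋃ _ : m ≤ n, {ω | h ≤ cusum F (Y ω) m} := by ext; simp
  rw [this]
  exact MeasurableSet.iUnion fun m => MeasurableSet.iUnion fun _ =>
    measurableSet_le measurable_const (measurable_cusum hF hY m)

theorem measurable_observation {X₀ X₁ : ℕ → Ω → S} {τ : Ω → ℕ∞}
    (hX₀ : ∀ k, Measurable (X₀ k)) (hX₁ : ∀ k, Measurable (X₁ k)) (hτ : Measurable τ) (k : ℕ) :
    Measurable fun ω => observation (fun k => X₀ k ω) (fun k => X₁ k ω) (τ ω) k :=
  Measurable.ite (hτ (MeasurableSet.of_discrete (s := {t : ℕ∞ | (k : ℕ∞) < t})))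
    (hX₀ k) (hX₁ k)

theorem measurable_alarm (hF : Measurable F) {X₀ X₁ : ℕ → Ω → S} {τ : Ω → ℕ∞}
    (hX₀ : ∀ k, Measurable (X₀ k)) (hX₁ : ∀ k, Measurable (X₁ k)) (hτ : Measurable τ) (h : ℝ) :
    Measurable (alarm X₀ X₁ τ F h) :=
  measurable_alarmTime hF (measurable_observation hX₀ hX₁ hτ) h

end Measurability

/-- The mean detection eagerness only depends on the alarm time of the pre-change sequence and is
the sum of the probabilities that the alarm has occurred and the change has not. -/
theorem MDE_eq_tsum {Ω S : Type*} [MeasurableSpace Ω] [MeasurableSpace S] {P : Measure Ω}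
    {X₀ X₁ : ℕ → Ω → S} {τ : Ω → ℕ∞}
    (hX₀ : ∀ k, Measurable (X₀ k)) (hX₁ : ∀ k, Measurable (X₁ k)) (hτ : Measurable τ)
    (indepτ₀ : IndepFun (fun ω k => X₀ k ω) τ P) {F : S → ℝ} (hF : Measurable F) (h : ℝ) :
    MDE P X₀ X₁ τ F h = ∑' n : ℕ, P {ω | alarmTime F (fun k => X₀ k ω) h ≤ n} *
      P {ω | (n : ℕ∞) < τ ω} := by
  have ha := measurable_alarm hF hX₀ hX₁ hτ h
  have hset : ∀ n : ℕ, MeasurableSet {ω | alarm X₀ X₁ τ F h ω ≤ n ∧ (n : ℕ∞) < τ ω} := fun n =>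
    (ha (MeasurableSet.of_discrete (s := {t : ℕ∞ | t ≤ n}))).inter
      (hτ (MeasurableSet.of_discrete (s := {t : ℕ∞ | (n : ℕ∞) < t})))
  have hind : ∀ (n : ℕ) (ω : Ω),
      ({n : ℕ | alarm X₀ X₁ τ F h ω ≤ n ∧ (n : ℕ∞) < τ ω}.indicator 1 n : ℝ≥0∞) =
      {ω | alarm X₀ X₁ τ F h ω ≤ n ∧ (n : ℕ∞) < τ ω}.indicator 1 ω := fun n ω => by
    simp [Set.indicator]
  unfold MDE
  simp only [ENat.toENNReal_sub_eq_tsum, hind]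
  rw [lintegral_tsum fun n => (measurable_one.indicator (hset n)).aemeasurable]
  refine tsum_congr fun n => ?_
  rw [lintegral_indicator_one (hset n)]
  -- On `n < τ` the alarm is decided by `X₀` alone, which is independent of `τ`.
  simp only [alarm, alarmTime_observation_le_and_lt_iff]
  exact indepτ₀.measure_inter_preimage_eq_mul {x | alarmTime F x h ≤ n} {t | (n : ℕ∞) < t}
    (measurable_alarmTime hF (Y := id) (fun k => measurable_pi_apply k) h
      (MeasurableSet.of_discrete (s := {t : ℕ∞ | t ≤ n}))) MeasurableSet.of_discrete

theorem _root_.HasDerivAt.eventually_lt_right {f : ℝ → ℝ} {f' x : ℝ} (hf : HasDerivAt f f' x)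
    (hf' : f' < 0) : ∀ᶠ t in 𝓝[>] x, f t < f x := by
  have h1 := (hasDerivAt_iff_tendsto_slope.1 hf).mono_left
    (nhdsWithin_mono x (show Set.Ioi x ⊆ {x}ᶜ from fun y hy => ne_of_gt hy))
  filter_upwards [h1.eventually (gt_mem_nhds hf'), self_mem_nhdsWithin] with t ht hxt
  rw [slope_def_field, div_lt_iff₀ (sub_pos.2 hxt), zero_mul] at ht
  linarith

/-- Supplies the small margins below: a rate that depends continuously on the margin still satisfies
a strict bound. -/
theorem exists_pos_lt_and_lt {f : ℝ → ℝ} (hf : ContinuousAt f 0) {a b : ℝ} (ha : f 0 < a)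
    (hb : 0 < b) : ∃ ε, 0 < ε ∧ ε < b ∧ f ε < a :=
  ((eventually_mem_nhdsWithin (a := (0 : ℝ)) (s := Set.Ioi 0)).and
    (((gt_mem_nhds hb).filter_mono nhdsWithin_le_nhds).and
      ((hf.eventually (gt_mem_nhds ha)).filter_mono nhdsWithin_le_nhds))).exists

/-! ### Chernoff and Cramér bounds for i.i.d. sums -/

section IID

variable {Ω : Type*} [MeasurableSpace Ω] {P : Measure Ω} {G : ℕ → Ω → ℝ}

theorem mgf_sum_iid (hind : iIndepFun G P) (hG : ∀ k, Measurable (G k))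
    (hid : ∀ k, IdentDistrib (G k) (G 0) P P) (s : Finset ℕ) (t : ℝ) :
    mgf (fun ω => ∑ j ∈ s, G j ω) P t = mgf (G 0) P t ^ s.card := by
  have := hind.mgf_sum (t := t) hG s
  rw [show (∑ i ∈ s, G i) = fun ω => ∑ j ∈ s, G j ω by ext; simp] at this
  rw [this, Finset.prod_congr rfl fun i _ => by rw [mgf_congr_identDistrib (hid i)],
    Finset.prod_const]

variable [IsProbabilityMeasure P]

theorem integrable_exp_sum_iid (hind : iIndepFun G P) (hG : ∀ k, Measurable (G k))
    (hid : ∀ k, IdentDistrib (G k) (G 0) P P) (s : Finset ℕ) {t : ℝ}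
    (ht : Integrable (fun ω => Real.exp (t * G 0 ω)) P) :
    Integrable (fun ω => Real.exp (t * ∑ j ∈ s, G j ω)) P := by
  have := hind.integrable_exp_mul_sum (t := t) hG (s := s) fun i _ =>
    ((hid i).comp (u := fun x => Real.exp (t * x)) (by fun_prop)).integrable_iff.2 ht
  simpa using this

theorem measureReal_le_sum_le (hind : iIndepFun G P) (hG : ∀ k, Measurable (G k))
    (hid : ∀ k, IdentDistrib (G k) (G 0) P P) (s : Finset ℕ) {t : ℝ} (ht0 : 0 ≤ t)
    (ht : Integrable (fun ω => Real.exp (t * G 0 ω)) P) (h : ℝ) :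
    P.real {ω | h ≤ ∑ j ∈ s, G j ω} ≤ Real.exp (-(t * h)) * mgf (G 0) P t ^ s.card := by
  have := measure_ge_le_exp_mul_mgf h ht0 (integrable_exp_sum_iid hind hG hid s ht)
  rwa [mgf_sum_iid hind hG hid, neg_mul] at this

theorem measureReal_sum_le_le (hind : iIndepFun G P) (hG : ∀ k, Measurable (G k))
    (hid : ∀ k, IdentDistrib (G k) (G 0) P P) (s : Finset ℕ) {t : ℝ} (ht0 : 0 ≤ t)
    (ht : Integrable (fun ω => Real.exp (-t * G 0 ω)) P) (h : ℝ) :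
    P.real {ω | ∑ j ∈ s, G j ω ≤ h} ≤ Real.exp (t * h) * mgf (G 0) P (-t) ^ s.card := by
  have := measure_le_le_exp_mul_mgf h (neg_nonpos.2 ht0)
    (integrable_exp_sum_iid hind hG hid s ht)
  rwa [mgf_sum_iid hind hG hid, neg_neg] at this

/-- Lower bound of Cramér type, by an exponential change of measure. -/
theorem le_measureReal_le_sum (hind : iIndepFun G P) (hG : ∀ k, Measurable (G k))
    (hid : ∀ k, IdentDistrib (G k) (G 0) P P) (s : Finset ℕ) {v t h h' : ℝ} (hv : 0 ≤ v)
    (ht0 : 0 ≤ t)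
    (hi : Integrable (fun ω => Real.exp (v * G 0 ω)) P)
    (hi₁ : Integrable (fun ω => Real.exp ((v - t) * G 0 ω)) P)
    (hi₂ : Integrable (fun ω => Real.exp ((v + t) * G 0 ω)) P) :
    Real.exp (-(v * h')) * (mgf (G 0) P v ^ s.card - Real.exp (t * h) * mgf (G 0) P (v - t) ^ s.card
      - Real.exp (-(t * h')) * mgf (G 0) P (v + t) ^ s.card)
      ≤ P.real {ω | h ≤ ∑ j ∈ s, G j ω} := by
  have hmeas : Measurable fun ω => ∑ j ∈ s, G j ω := Finset.measurable_fun_sum s fun i _ => hG i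
  have I := integrable_exp_sum_iid hind hG hid s hi
  have I₁ := integrable_exp_sum_iid hind hG hid s hi₁
  have I₂ := integrable_exp_sum_iid hind hG hid s hi₂
  rw [← mgf_sum_iid hind hG hid s v, ← mgf_sum_iid hind hG hid s (v - t),
    ← mgf_sum_iid hind hG hid s (v + t)]
  set T : Ω → ℝ := fun ω => ∑ j ∈ s, G j ω with hT
  have hA : MeasurableSet {ω | h ≤ T ω} := measurableSet_le measurable_const hmeas
  -- Pointwise, e^(vT) is at most e^(th) e^((v-t)T) where T < h, at most e^(-th') e^((v+t)T) where T
  -- > h', and at most e^(vh') in between.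
  have key : mgf T P v ≤ Real.exp (v * h') * P.real {ω | h ≤ T ω}
      + Real.exp (t * h) * mgf T P (v - t) + Real.exp (-(t * h')) * mgf T P (v + t) := by
    have hind1 : Integrable ({ω | h ≤ T ω}.indicator fun _ => (1 : ℝ)) P :=
      (integrable_const 1).indicator hA
    calc mgf T P v = ∫ ω, Real.exp (v * T ω) ∂P := rfl
      _ ≤ ∫ ω, (Real.exp (v * h') * {ω | h ≤ T ω}.indicator (fun _ => (1 : ℝ)) ω
          + Real.exp (t * h) * Real.exp ((v - t) * T ω)
          + Real.exp (-(t * h')) * Real.exp ((v + t) * T ω)) ∂P := by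
        refine integral_mono I (((hind1.const_mul _).add (I₁.const_mul _)).add (I₂.const_mul _)) ?_
        intro ω
        simp only
        have p0 : 0 ≤ Real.exp (v * h') * {ω | h ≤ T ω}.indicator (fun _ => (1 : ℝ)) ω :=
          mul_nonneg (Real.exp_pos _).le (Set.indicator_nonneg (fun _ _ => zero_le_one) _)
        have p1 : 0 ≤ Real.exp (t * h) * Real.exp ((v - t) * T ω) := by positivity
        have p2 : 0 ≤ Real.exp (-(t * h')) * Real.exp ((v + t) * T ω) := by positivity
        rcases lt_or_ge (T ω) h with c1 | c1
        · have : Real.exp (v * T ω) ≤ Real.exp (t * h) * Real.exp ((v - t) * T ω) := by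
            rw [← Real.exp_add]
            exact Real.exp_le_exp.2 (by nlinarith)
          linarith
        · rcases lt_or_ge h' (T ω) with c2 | c2
          · have : Real.exp (v * T ω) ≤ Real.exp (-(t * h')) * Real.exp ((v + t) * T ω) := by
              rw [← Real.exp_add]
              exact Real.exp_le_exp.2 (by nlinarith)
            linarith
          · have : Real.exp (v * T ω) ≤
                Real.exp (v * h') * {ω | h ≤ T ω}.indicator (fun _ => (1 : ℝ)) ω := by
              rw [Set.indicator_of_mem (by exact c1), mul_one]
              exact Real.exp_le_exp.2 (by nlinarith)
            linarith
      _ = _ := by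
        have J : Integrable (fun ω => Real.exp (v * h') * {ω | h ≤ T ω}.indicator (fun _ => 1) ω
          + Real.exp (t * h) * Real.exp ((v - t) * T ω)) P :=
          (hind1.const_mul _).add (I₁.const_mul _)
        have J₂ : Integrable (fun ω => Real.exp (-(t * h')) * Real.exp ((v + t) * T ω)) P :=
          I₂.const_mul _
        have J₁ : Integrable (fun ω => Real.exp (t * h) * Real.exp ((v - t) * T ω)) P :=
          I₁.const_mul _
        rw [integral_add J J₂, integral_add (hind1.const_mul _) J₁, integral_const_mul,
          integral_const_mul, integral_const_mul, integral_indicator_const _ hA]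
        simp [mgf]
  rw [Real.exp_neg (v * h'), inv_mul_le_iff₀ (Real.exp_pos _)]
  linarith

end IID

/-! ### Convexity and positivity for moment generating functions -/

section LogMGF

variable {Ω : Type*} [MeasurableSpace Ω] {P : Measure Ω} {Z : Ω → ℝ}

theorem integrable_exp_of_logMGF_ne_top (hZ : Measurable Z) {v : ℝ} (hv : logMGF P Z v ≠ ⊤) :
    Integrable (fun ω => Real.exp (v * Z ω)) P := by
  refine (lintegral_ofReal_ne_top_iff_integrable (by fun_prop)
    (ae_of_all _ fun _ => (Real.exp_pos _).le)).1 ?_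
  simpa [logMGF] using hv

theorem mgf_eq_exp_of_logMGF_eq (hZ : Measurable Z) {v c : ℝ} (hv : logMGF P Z v = (c : EReal)) :
    mgf Z P v = Real.exp c := by
  have hi := integrable_exp_of_logMGF_ne_top hZ (v := v) (P := P) (by rw [hv]; exact EReal.coe_ne_top c)
  have h0 : ∫⁻ ω, ENNReal.ofReal (Real.exp (v * Z ω)) ∂P = ENNReal.ofReal (Real.exp c) := by
    refine ENNReal.log_injective ?_
    rw [ENNReal.log_ofReal_of_pos (Real.exp_pos _), Real.log_exp, ← hv, logMGF]
  rw [← ofReal_integral_eq_lintegral_ofReal hi (ae_of_all _ fun _ => (Real.exp_pos _).le)] at h0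
  exact (ENNReal.ofReal_eq_ofReal_iff (integral_nonneg fun _ => (Real.exp_pos _).le)
    (Real.exp_pos _).le).1 h0

theorem mem_interior_integrableExpSet (hZ : Measurable Z) {v : ℝ}
    (hv : ∀ᶠ u in 𝓝 v, logMGF P Z u ≠ ⊤) : v ∈ interior (integrableExpSet Z P) :=
  mem_interior_iff_mem_nhds.2 (hv.mono fun _ hu => integrable_exp_of_logMGF_ne_top hZ hu)

/-- A random variable with negative mean has positive log moment generating function on the
negative half-line. -/
theorem one_lt_mgf_of_integral_neg [IsProbabilityMeasure P] (hneg : ∫ ω, Z ω ∂P < 0) {v : ℝ}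
    (hv : v < 0) (hi : Integrable (fun ω => Real.exp (v * Z ω)) P) : 1 < mgf Z P v := by
  -- A non-integrable `Z` would have the default integral zero.
  have hZ : Integrable Z P := by
    by_contra hc
    rw [integral_undef hc] at hneg
    exact lt_irrefl _ hneg
  have : ∫ ω, (v * Z ω + 1) ∂P ≤ mgf Z P v :=
    integral_mono ((hZ.const_mul v).add (integrable_const 1)) hi fun ω => Real.add_one_le_exp _
  rw [integral_add (hZ.const_mul v) (integrable_const 1), integral_const_mul] at this
  simp only [integral_const, probReal_univ, smul_eq_mul, mul_one] at this
  nlinarith [mul_pos_of_neg_of_neg hv hneg]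

/-- By convexity the function lies below its chord, which is below `b` left of `w`. Applied between
υ₀, with value 1, and υ₊, with value e^ϱ. -/
theorem mgf_lt_of_mem_Ioo {u v w a b : ℝ} (hu : Integrable (fun ω => Real.exp (u * Z ω)) P)
    (hw : Integrable (fun ω => Real.exp (w * Z ω)) P) (huv : u < v) (hvw : v < w)
    (ha : mgf Z P u = a) (hb : mgf Z P w = b) (hab : a < b) : mgf Z P v < b := by
  have hi : Integrable (fun ω => Real.exp (v * Z ω)) P :=
    integrable_exp_mul_of_le_of_le hu hw huv.le hvw.le
  have hd : 0 < w - u := by linarith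
  have : mgf Z P v ≤ ∫ ω, ((w - v) / (w - u) * Real.exp (u * Z ω) +
      (v - u) / (w - u) * Real.exp (w * Z ω)) ∂P := by
    refine integral_mono hi ((hu.const_mul _).add (hw.const_mul _)) fun ω => ?_
    have := convexOn_exp.2 (Set.mem_univ (u * Z ω)) (Set.mem_univ (w * Z ω))
      (show 0 ≤ (w - v) / (w - u) from div_nonneg (by linarith) hd.le)
      (show 0 ≤ (v - u) / (w - u) from div_nonneg (by linarith) hd.le) (by field_simp; ring)
    simp only [smul_eq_mul] at this
    convert this using 2
    field_simp
    ring
  rw [integral_add (hu.const_mul _) (hw.const_mul _), integral_const_mul, integral_const_mul] at this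
  change _ ≤ _ * mgf Z P u + _ * mgf Z P w at this
  rw [ha, hb] at this
  refine this.trans_lt ?_
  have e : (w - v) / (w - u) * a + (v - u) / (w - u) * b = b - (w - v) / (w - u) * (b - a) := by
    field_simp; ring
  rw [e]
  have : 0 < (w - v) / (w - u) * (b - a) := mul_pos (div_pos (by linarith) hd) (by linarith)
  linarith

/-- Since e^x - x e^x ≤ 1, the integral times `v` is at least M(v) - 1. Thus the tilted walk has
positive drift. -/
theorem integral_mul_exp_pos [IsProbabilityMeasure P] {v : ℝ} (hv : 0 < v)
    (hint : v ∈ interior (integrableExpSet Z P)) (hM : 1 < mgf Z P v) :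
    0 < ∫ ω, Z ω * Real.exp (v * Z ω) ∂P := by
  have hi : Integrable (fun ω => Real.exp (v * Z ω)) P :=
    interior_subset (s := integrableExpSet Z P) hint
  have hi' : Integrable (fun ω => Z ω * Real.exp (v * Z ω)) P := by
    simpa using integrable_pow_mul_exp_of_mem_interior_integrableExpSet hint 1
  have : ∫ ω, (Real.exp (v * Z ω) - v * (Z ω * Real.exp (v * Z ω))) ∂P ≤ ∫ _, (1 : ℝ) ∂P := by
    refine integral_mono (hi.sub (hi'.const_mul v)) (integrable_const 1) fun ω => ?_
    have h1 := Real.add_one_le_exp (-(v * Z ω))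
    have h2 := mul_le_mul_of_nonneg_right h1 (Real.exp_pos (v * Z ω)).le
    rw [← Real.exp_add, neg_add_cancel, Real.exp_zero] at h2
    simp only
    linarith
  rw [integral_sub hi (hi'.const_mul v), integral_const_mul] at this
  simp only [integral_const, probReal_univ, smul_eq_mul, mul_one] at this
  have h3 : 0 < v * ∫ ω, Z ω * Real.exp (v * Z ω) ∂P := by
    change mgf Z P v - _ ≤ 1 at this
    linarith
  exact (mul_pos_iff_of_pos_left hv).1 h3

end LogMGF

/-! ### Exponential bounds on the tail of the change time -/

section Tail

variable {Ω : Type*} [MeasurableSpace Ω] {P : Measure Ω} [IsProbabilityMeasure P] {τ : Ω → ℕ∞}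
  {ϱ : ℝ}

theorem RegularGeometricTail.eventually_le (tail : RegularGeometricTail P τ ϱ) {r : ℝ}
    (hr : r < ϱ) :
    ∀ᶠ n : ℕ in atTop, P.real {ω | (n : ℕ∞) ≤ τ ω} ≤ Real.exp (-(r * n)) := by
  filter_upwards [tail.eventually (gt_mem_nhds (EReal.coe_lt_coe_iff.2 (neg_lt_neg hr))),
    eventually_gt_atTop 0] with n h hn
  have hn' : (0 : ℝ) < n := Nat.cast_pos.2 hn
  rcases (measureReal_nonneg (μ := P) (s := {ω | (n : ℕ∞) ≤ τ ω})).eq_or_lt with h0 | h0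
  · rw [← h0]; positivity
  · rw [← ofReal_measureReal, ENNReal.log_ofReal_of_pos h0, ← EReal.coe_mul,
      EReal.coe_lt_coe_iff] at h
    rw [← Real.log_le_iff_le_exp h0]
    rw [one_div, inv_mul_lt_iff₀ hn'] at h
    linarith

theorem RegularGeometricTail.eventually_ge (tail : RegularGeometricTail P τ ϱ) {r : ℝ}
    (hr : ϱ < r) :
    ∀ᶠ n : ℕ in atTop, Real.exp (-(r * n)) ≤ P.real {ω | (n : ℕ∞) ≤ τ ω} := by
  filter_upwards [tail.eventually (lt_mem_nhds (EReal.coe_lt_coe_iff.2 (neg_lt_neg hr))),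
    eventually_gt_atTop 0] with n h hn
  have hn' : (0 : ℝ) < n := Nat.cast_pos.2 hn
  rcases (measureReal_nonneg (μ := P) (s := {ω | (n : ℕ∞) ≤ τ ω})).eq_or_lt with h0 | h0
  -- A null tail would have logarithm ⊥, which cannot exceed `-r`.
  · rw [← ofReal_measureReal, ← h0, ENNReal.ofReal_zero, ENNReal.log_zero,
      EReal.coe_mul_bot_of_pos (by positivity)] at h
    exact absurd h not_lt_bot
  · rw [← ofReal_measureReal, ENNReal.log_ofReal_of_pos h0, ← EReal.coe_mul,
      EReal.coe_lt_coe_iff] at h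
    rw [← Real.le_log_iff_exp_le h0]
    rw [one_div, lt_inv_mul_iff₀ hn'] at h
    linarith

theorem RegularGeometricTail.exists_le (tail : RegularGeometricTail P τ ϱ) {r : ℝ}
    (hr0 : 0 ≤ r) (hr : r < ϱ) :
    ∃ C : ℝ, 0 < C ∧ ∀ n : ℕ, P.real {ω | (n : ℕ∞) < τ ω} ≤ C * Real.exp (-(r * n)) := by
  obtain ⟨N, hN⟩ := eventually_atTop.1 (tail.eventually_le hr)
  refine ⟨Real.exp (r * N), Real.exp_pos _, fun n => ?_⟩
  rw [← Real.exp_add]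
  rcases lt_or_ge n N with hn | hn
  · refine measureReal_le_one.trans (Real.one_le_exp ?_)
    have : (n : ℝ) ≤ N := Nat.cast_le.2 hn.le
    nlinarith
  · refine (measureReal_mono (s₂ := {ω | (n : ℕ∞) ≤ τ ω}) fun ω hω =>
      le_of_lt (show (n : ℕ∞) < τ ω from hω)).trans
      ((hN n hn).trans (Real.exp_le_exp.2 ?_))
    have : (0 : ℝ) ≤ N := Nat.cast_nonneg N
    nlinarith

theorem RegularGeometricTail.exists_ge (tail : RegularGeometricTail P τ ϱ) {r : ℝ}
    (hr : ϱ < r) :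
    ∃ c : ℝ, 0 < c ∧ ∀ n : ℕ, c * Real.exp (-(r * n)) ≤ P.real {ω | (n : ℕ∞) < τ ω} := by
  obtain ⟨N, hN⟩ := eventually_atTop.1 (tail.eventually_ge hr)
  refine ⟨Real.exp (-(r * (N + 1))), Real.exp_pos _, fun n => ?_⟩
  rw [← Real.exp_add]
  -- The shift by `N` reaches the range of the eventual bound; the extra 1 turns `≤ τ` into `< τ`.
  have hle := hN (n + 1 + N) (by omega)
  refine (Real.exp_le_exp.2 ?_).trans (hle.trans (measureReal_mono fun ω hω => ?_))
  · push_cast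
    linarith
  · exact lt_of_lt_of_le (Nat.cast_lt.2 (by omega)) (show _ ≤ τ ω from hω)

end Tail

/-! ### Exponential rate of the mean detection eagerness -/

section Eagerness

variable {Ω S : Type*} [MeasurableSpace Ω] [MeasurableSpace S] {P : Measure Ω}
  [IsProbabilityMeasure P] {X₀ X₁ : ℕ → Ω → S} {τ : Ω → ℕ∞} {F : S → ℝ} {ϱ v : ℝ}

/-- An alarm by time `n` needs one of at most (n+1)² windows to have sum at least `h`. As `B ≥ 1`,
each window length may be replaced by `n`. -/
theorem measureReal_alarmTime_le_le (hX₀ : ∀ k, Measurable (X₀ k))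
    (indep₀ : iIndepFun X₀ P) (ident₀ : ∀ k, IdentDistrib (X₀ k) (X₀ 0) P P)
    (hF : Measurable F) (hv : 0 ≤ v)
    (hi : Integrable (fun ω => Real.exp (v * F (X₀ 0 ω))) P) {B : ℝ} (hB1 : 1 ≤ B)
    (hB : mgf (fun ω => F (X₀ 0 ω)) P v ≤ B) (h : ℝ) (n : ℕ) :
    P.real {ω | alarmTime F (fun k => X₀ k ω) h ≤ n} ≤
      (n + 1) ^ 2 * (Real.exp (-(v * h)) * B ^ n) := by
  have hind : iIndepFun (fun k ω => F (X₀ k ω)) P := indep₀.comp (fun _ => F) fun _ => hF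
  have hid : ∀ k, IdentDistrib (fun ω => F (X₀ k ω)) (fun ω => F (X₀ 0 ω)) P P :=
    fun k => (ident₀ k).comp hF
  have hsub : {ω | alarmTime F (fun k => X₀ k ω) h ≤ n} ⊆
      ⋃ p ∈ Finset.range (n + 1) ×ˢ Finset.range (n + 1),
        {ω | h ≤ ∑ j ∈ Finset.Ico (p.1 + 1) (p.2 + 1), F (X₀ j ω)} := by
    intro ω hω
    obtain ⟨m, hm, hhm⟩ := alarmTime_le_iff.1 hω
    obtain ⟨a, ha, he⟩ := exists_cusum_eq_sum F (fun k => X₀ k ω) m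
    simp only [Set.mem_iUnion]
    refine ⟨(a, m), by simp; omega, ?_⟩
    rw [Set.mem_ofPred_eq, ← Finset.sum_Ico_add' (fun j => F (X₀ j ω)) a m 1, ← he]
    exact hhm
  refine (measureReal_mono hsub (measure_ne_top _ _)).trans ((measureReal_biUnion_finset_le _ _).trans ?_)
  refine (Finset.sum_le_card_nsmul _ _ (Real.exp (-(v * h)) * B ^ n) fun p hp => ?_).trans_eq ?_
  · refine (measureReal_le_sum_le hind (fun k => hF.comp (hX₀ k)) hid _ hv hi h).trans ?_
    refine mul_le_mul_of_nonneg_left ?_ (Real.exp_pos _).le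
    refine (pow_le_pow_left₀ mgf_nonneg hB _).trans (pow_le_pow_right₀ hB1 ?_)
    simp only [Finset.mem_product, Finset.mem_range] at hp
    rw [Nat.card_Ico]
    omega
  · rw [Finset.card_product, Finset.card_range, nsmul_eq_mul]
    push_cast
    ring

theorem exists_MDE_le (hX₀ : ∀ k, Measurable (X₀ k)) (hX₁ : ∀ k, Measurable (X₁ k))
    (hτ : Measurable τ) (indep₀ : iIndepFun X₀ P)
    (ident₀ : ∀ k, IdentDistrib (X₀ k) (X₀ 0) P P) (indepτ₀ : IndepFun (fun ω k => X₀ k ω) τ P)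
    (hF : Measurable F) (hϱ : 0 < ϱ) (tail : RegularGeometricTail P τ ϱ) (hv : 0 ≤ v)
    (hi : Integrable (fun ω => Real.exp (v * F (X₀ 0 ω))) P)
    (hM : mgf (fun ω => F (X₀ 0 ω)) P v < Real.exp ϱ) :
    ∃ K : ℝ, 0 < K ∧ ∀ h : ℝ,
      MDE P X₀ X₁ τ F h ≤ ENNReal.ofReal (K * Real.exp (-(v * h))) := by
  set B := max (mgf (fun ω => F (X₀ 0 ω)) P v) 1 with hBdef
  have hB1 : 1 ≤ B := le_max_right _ _
  have hB0 : 0 < B := by linarith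
  have hBϱ : Real.log B < ϱ :=
    (Real.log_lt_iff_lt_exp hB0).2 (max_lt hM (Real.one_lt_exp_iff.2 hϱ))
  -- The gap between log B and ϱ makes the ratio q = B e^(-r) less than 1, so the polynomial factor
  -- is harmless.
  obtain ⟨r, hr1, hr2⟩ := exists_between hBϱ
  have hr0 : 0 ≤ r := (Real.log_nonneg hB1).trans hr1.le
  obtain ⟨C, hC, hCn⟩ := tail.exists_le hr0 hr2
  set q := B * Real.exp (-r) with hq
  have hq0 : 0 < q := by positivity
  have hq1 : q < 1 := by
    rw [hq, Real.exp_neg, ← div_eq_mul_inv, div_lt_one (Real.exp_pos _)]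
    exact (Real.log_lt_iff_lt_exp hB0).1 hr1
  have hsum : Summable fun n : ℕ => ((n : ℝ) + 1) ^ 2 * q ^ n := by
    have h1 := (summable_nat_add_iff 1).2 (summable_pow_mul_geometric_of_norm_lt_one 2
      (r := q) (by rwa [Real.norm_of_nonneg hq0.le]))
    refine (h1.mul_right q⁻¹).congr fun n => ?_
    push_cast
    rw [mul_assoc, pow_succ q, mul_assoc (q ^ n), mul_inv_cancel₀ hq0.ne', mul_one]
  have hterm : ∀ (h : ℝ) (n : ℕ), P {ω | alarmTime F (fun k => X₀ k ω) h ≤ n} *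
      P {ω | (n : ℕ∞) < τ ω} ≤
      ENNReal.ofReal (C * Real.exp (-(v * h)) * (((n : ℝ) + 1) ^ 2 * q ^ n)) := fun h n => by
    rw [← ofReal_measureReal, ← ofReal_measureReal, ← ENNReal.ofReal_mul measureReal_nonneg]
    refine ENNReal.ofReal_le_ofReal ((mul_le_mul
      (measureReal_alarmTime_le_le hX₀ indep₀ ident₀ hF hv hi hB1 (le_max_left _ _) h n) (hCn n)
      measureReal_nonneg (by positivity)).trans_eq ?_)
    rw [hq, mul_pow, ← Real.exp_nat_mul, show -(r * n) = n * -r by ring]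
    ring
  have hpos : 0 < ∑' n : ℕ, ((n : ℝ) + 1) ^ 2 * q ^ n :=
    hsum.tsum_pos (fun n => by positivity) 0 (by positivity)
  refine ⟨C * ∑' n : ℕ, ((n : ℝ) + 1) ^ 2 * q ^ n, by positivity, fun h => ?_⟩
  rw [MDE_eq_tsum hX₀ hX₁ hτ indepτ₀ hF h]
  refine (ENNReal.tsum_le_tsum (hterm h)).trans_eq ?_
  rw [← ENNReal.ofReal_tsum_of_nonneg (fun n => by positivity) (hsum.mul_left _), tsum_mul_left]
  congr 1
  ring

/-- Here `a` is the tilted mean. The bases e^(t(a-δ)) M(v-t) and e^(-t(a+δ)) M(v+t) of the two error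
terms equal M(v) at t = 0 and have slope -δM(v) there. A small t > 0 thus makes their powers
negligible against that of M(v). -/
theorem exists_le_measureReal_sum {G : ℕ → Ω → ℝ} (hind : iIndepFun G P)
    (hG : ∀ k, Measurable (G k)) (hid : ∀ k, IdentDistrib (G k) (G 0) P P) (hv : 0 < v)
    (hint : v ∈ interior (integrableExpSet (G 0) P)) {a δ : ℝ}
    (ha : a = (∫ ω, G 0 ω * Real.exp (v * G 0 ω) ∂P) / mgf (G 0) P v) (hδ : 0 < δ) :
    ∃ n₀ : ℕ, ∀ s : Finset ℕ, n₀ ≤ s.card →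
      2⁻¹ * (Real.exp (-(v * (s.card * (a + δ)))) * mgf (G 0) P v ^ s.card)
        ≤ P.real {ω | s.card * (a - δ) ≤ ∑ j ∈ s, G j ω} := by
  set M := mgf (G 0) P with hMdef
  have hi : Integrable (fun ω => Real.exp (v * G 0 ω)) P :=
    interior_subset (s := integrableExpSet (G 0) P) hint
  have hM0 : 0 < M v := mgf_pos hi
  have hd := hasDerivAt_mgf hint
  set D := ∫ ω, G 0 ω * Real.exp (v * G 0 ω) ∂P with hD
  have hDa : D = a * M v := by rw [ha]; field_simp
  have d1 : HasDerivAt (fun t => Real.exp (t * (a - δ)) * M (v - t)) (-(δ * M v)) 0 := by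
    have e1 : HasDerivAt (fun t : ℝ => Real.exp (t * (a - δ))) (a - δ) 0 := by
      simpa using ((hasDerivAt_id (0 : ℝ)).mul_const (a - δ)).exp
    have e2 : HasDerivAt (fun t : ℝ => M (v - t)) (-D) 0 := by
      exact HasDerivAt.comp_const_sub v 0 (by simpa using hd)
    refine (e1.mul e2).congr_deriv ?_
    simp [hDa]; ring
  have d2 : HasDerivAt (fun t => Real.exp (-(t * (a + δ))) * M (v + t)) (-(δ * M v)) 0 := by
    have e1 : HasDerivAt (fun t : ℝ => Real.exp (-(t * (a + δ)))) (-(a + δ)) 0 := by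
      simpa using ((hasDerivAt_id (0 : ℝ)).mul_const (a + δ)).neg.exp
    have e2 : HasDerivAt (fun t : ℝ => M (v + t)) D 0 := by
      exact HasDerivAt.comp_const_add v 0 (by simpa using hd)
    refine (e1.mul e2).congr_deriv ?_
    simp [hDa]; ring
  have hneg : -(δ * M v) < 0 := neg_lt_zero.2 (mul_pos hδ hM0)
  have i1 : ∀ᶠ t : ℝ in 𝓝[>] 0, v - t ∈ integrableExpSet (G 0) P := by
    refine Filter.Eventually.filter_mono nhdsWithin_le_nhds ?_
    have : Tendsto (fun t : ℝ => v - t) (𝓝 0) (𝓝 v) :=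
      Continuous.tendsto' (by fun_prop) _ _ (by simp)
    exact this.eventually (mem_interior_iff_mem_nhds.1 hint)
  have i2 : ∀ᶠ t : ℝ in 𝓝[>] 0, v + t ∈ integrableExpSet (G 0) P := by
    refine Filter.Eventually.filter_mono nhdsWithin_le_nhds ?_
    have : Tendsto (fun t : ℝ => v + t) (𝓝 0) (𝓝 v) :=
      Continuous.tendsto' (by fun_prop) _ _ (by simp)
    exact this.eventually (mem_interior_iff_mem_nhds.1 hint)
  obtain ⟨t, ht0, ht1, ht2, hi1, hi2⟩ := ((eventually_mem_nhdsWithin (a := (0 : ℝ)) (s := Set.Ioi 0)).and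
    ((d1.eventually_lt_right hneg).and ((d2.eventually_lt_right hneg).and (i1.and i2)))).exists
  have ht0' : 0 < t := ht0
  simp only [zero_mul, Real.exp_zero, sub_zero, one_mul, neg_zero, add_zero] at ht1 ht2
  -- A quarter for each error term leaves the factor 1/2.
  have hpow : ∀ x : ℝ, 0 ≤ x → x < M v → ∀ᶠ n : ℕ in atTop, x ^ n ≤ 4⁻¹ * M v ^ n := by
    intro x hx hxM
    have := (tendsto_pow_atTop_nhds_zero_of_lt_one (div_nonneg hx hM0.le)
      ((div_lt_one hM0).2 hxM)).eventually (gt_mem_nhds (show (0 : ℝ) < 4⁻¹ by norm_num))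
    filter_upwards [this] with n hn
    rw [div_pow, div_lt_iff₀ (by positivity)] at hn
    exact hn.le
  obtain ⟨n₀, hn₀⟩ := eventually_atTop.1
    ((hpow _ (mul_nonneg (Real.exp_pos _).le mgf_nonneg) ht1).and
      (hpow _ (mul_nonneg (Real.exp_pos _).le mgf_nonneg) ht2))
  refine ⟨n₀, fun s hs => ?_⟩
  obtain ⟨b1, b2⟩ := hn₀ s.card hs
  refine le_trans ?_ (le_measureReal_le_sum hind hG hid s (h' := s.card * (a + δ)) hv.le ht0'.le
    hi hi1 hi2)
  rw [mul_pow, ← Real.exp_nat_mul] at b1 b2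
  rw [show t * (s.card * (a - δ)) = s.card * (t * (a - δ)) by ring,
    show -(t * (s.card * (a + δ))) = s.card * -(t * (a + δ)) by ring, mul_left_comm]
  refine mul_le_mul_of_nonneg_left ?_ (Real.exp_pos _).le
  change _ ≤ M v ^ _ - _ * M _ ^ _ - _ * M _ ^ _
  linarith

theorem exists_le_MDE (hX₀ : ∀ k, Measurable (X₀ k)) (hX₁ : ∀ k, Measurable (X₁ k))
    (hτ : Measurable τ) (indep₀ : iIndepFun X₀ P)
    (ident₀ : ∀ k, IdentDistrib (X₀ k) (X₀ 0) P P) (indepτ₀ : IndepFun (fun ω k => X₀ k ω) τ P)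
    (hF : Measurable F) (hϱ : 0 < ϱ) (tail : RegularGeometricTail P τ ϱ) (hv : 0 < v)
    (hint : v ∈ interior (integrableExpSet (fun ω => F (X₀ 0 ω)) P))
    (hM : mgf (fun ω => F (X₀ 0 ω)) P v = Real.exp ϱ) {ε : ℝ} (hε : 0 < ε) :
    ∃ K : ℝ, 0 < K ∧ ∀ h : ℝ, 0 ≤ h →
      ENNReal.ofReal (K * Real.exp (-((v + ε) * h))) ≤ MDE P X₀ X₁ τ F h := by
  have hind : iIndepFun (fun k ω => F (X₀ k ω)) P := indep₀.comp (fun _ => F) fun _ => hF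
  have hid : ∀ k, IdentDistrib (fun ω => F (X₀ k ω)) (fun ω => F (X₀ 0 ω)) P P :=
    fun k => (ident₀ k).comp hF
  obtain ⟨a, ha⟩ : ∃ a, a = (∫ ω, F (X₀ 0 ω) * Real.exp (v * F (X₀ 0 ω)) ∂P) /
    mgf (fun ω => F (X₀ 0 ω)) P v := ⟨_, rfl⟩
  have ha0 : 0 < a := by
    rw [ha]
    refine div_pos (integral_mul_exp_pos hv hint ?_) ?_
    · rw [hM]; exact Real.one_lt_exp_iff.2 hϱ
    · rw [hM]; exact Real.exp_pos _
  obtain ⟨δ, hδ, hδa, hδε⟩ : ∃ δ : ℝ, 0 < δ ∧ δ < a ∧ (v * (a + δ) + δ) / (a - δ) < v + ε := by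
    refine exists_pos_lt_and_lt (f := fun δ => (v * (a + δ) + δ) / (a - δ))
      (ContinuousAt.div (by fun_prop) (by fun_prop)
      (by simpa using ha0.ne')) ?_ ha0
    simp only [add_zero, sub_zero, mul_div_cancel_right₀ v ha0.ne']
    linarith
  obtain ⟨n₀, hn₀⟩ := exists_le_measureReal_sum hind (fun k => hF.comp (hX₀ k)) hid hv hint ha hδ
  obtain ⟨c, hc, hcn⟩ := tail.exists_ge (r := ϱ + δ) (by linarith)
  have haδ : 0 < a - δ := by linarith
  set w := v * (a + δ) + δ with hw
  have hw0 : 0 < w := by positivity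
  refine ⟨2⁻¹ * c * Real.exp (-((n₀ + 1) * w)), by positivity, fun h hh => ?_⟩
  rw [MDE_eq_tsum hX₀ hX₁ hτ indepτ₀ hF h]
  -- About the time at which the tilted walk reaches `h`; adding `n₀` brings `n` into the range of
  -- the Cramér bound.
  set n : ℕ := n₀ + ⌈h / (a - δ)⌉₊ with hn
  refine le_trans ?_ (ENNReal.le_tsum n)
  rw [← ofReal_measureReal, ← ofReal_measureReal, ← ENNReal.ofReal_mul measureReal_nonneg]
  refine ENNReal.ofReal_le_ofReal ?_
  -- The window starts at 1 because the statistic never reads observation 0.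
  have hcard : (Finset.Ico 1 (n + 1)).card = n := by simp
  have hlow := hn₀ (Finset.Ico 1 (n + 1)) (by rw [hcard, hn]; omega)
  rw [hcard, hM] at hlow
  have hceil : h / (a - δ) ≤ n := (Nat.le_ceil _).trans (Nat.cast_le.2 (by omega))
  have hsub : P.real {ω | n * (a - δ) ≤ ∑ j ∈ Finset.Ico 1 (n + 1), F (X₀ j ω)} ≤
      P.real {ω | alarmTime F (fun k => X₀ k ω) h ≤ n} := by
    refine measureReal_mono fun ω hω => alarmTime_le_iff.2 ⟨n, le_rfl, ?_⟩
    have h1 : n * (a - δ) ≤ ∑ j ∈ Finset.Ico 1 (n + 1), F (X₀ j ω) := hω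
    have h2 := sum_le_cusum_add F (fun k => X₀ k ω) 0 n
    rw [zero_add, zero_add] at h2
    rw [Finset.sum_Ico_eq_sum_range, Nat.add_sub_cancel] at h1
    exact (((div_le_iff₀ haδ).1 hceil).trans h1).trans h2
  refine le_trans ?_ (mul_le_mul (hlow.trans hsub) (hcn n) (by positivity) measureReal_nonneg)
  have hnle : (n : ℝ) ≤ n₀ + 1 + h / (a - δ) := by
    have := (Nat.ceil_lt_add_one (div_nonneg hh haδ.le)).le
    rw [hn]
    push_cast
    linarith
  -- The growth e^(ϱn) cancels against the tail of `τ`, leaving the rate `w` per step.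
  have e1 : 2⁻¹ * (Real.exp (-(v * (n * (a + δ)))) * Real.exp ϱ ^ n) *
      (c * Real.exp (-((ϱ + δ) * n))) = 2⁻¹ * c * Real.exp (-(n * w)) := by
    rw [← Real.exp_nat_mul, show 2⁻¹ * (Real.exp (-(v * (n * (a + δ)))) * Real.exp (n * ϱ)) *
      (c * Real.exp (-((ϱ + δ) * n))) = 2⁻¹ * c * (Real.exp (-(v * (n * (a + δ)))) *
        Real.exp (n * ϱ) * Real.exp (-((ϱ + δ) * n))) by ring, ← Real.exp_add, ← Real.exp_add, hw]
    congr 2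
    ring
  rw [e1, mul_assoc, ← Real.exp_add]
  refine mul_le_mul_of_nonneg_left (Real.exp_le_exp.2 ?_) (by positivity)
  have e2 : w / (a - δ) * h ≤ (v + ε) * h := mul_le_mul_of_nonneg_right hδε.le hh
  have e3 : (n : ℝ) * w ≤ (n₀ + 1 + h / (a - δ)) * w := mul_le_mul_of_nonneg_right hnle hw0.le
  have e4 : h / (a - δ) * w = w / (a - δ) * h := by ring
  linarith

end Eagerness

/-! ### Auxiliary bounds for the delay -/

/-- The bound 1 is used up to n = ⌈A/s⌉, where the exponent has become nonpositive, and a geometric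
series after that. -/
theorem _root_.ENNReal.tsum_le_of_geometric {b : ℕ → ℝ≥0∞} {A s : ℝ} (hA : 0 ≤ A) (hs : 0 < s)
    (hb1 : ∀ n, b n ≤ 1) (hb : ∀ n, b n ≤ ENNReal.ofReal (Real.exp (A - s * n))) :
    ∑' n, b n ≤ ENNReal.ofReal (A / s + 1 + (1 - Real.exp (-s))⁻¹) := by
  have hq1 : Real.exp (-s) < 1 := Real.exp_lt_one_iff.2 (by linarith)
  set N : ℕ := ⌈A / s⌉₊ with hN
  have hsN : A ≤ s * N := by
    have := Nat.le_ceil (A / s)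
    rwa [div_le_iff₀' hs] at this
  rw [← Summable.sum_add_tsum_nat_add' (k := N) ENNReal.summable]
  have h1 : ∑ n ∈ Finset.range N, b n ≤ ENNReal.ofReal (A / s + 1) := by
    calc ∑ n ∈ Finset.range N, b n ≤ ∑ n ∈ Finset.range N, 1 := Finset.sum_le_sum fun n _ => hb1 n
      _ = ENNReal.ofReal N := by simp
      _ ≤ _ := ENNReal.ofReal_le_ofReal (Nat.ceil_lt_add_one (div_nonneg hA hs.le)).le
  have h2 : ∑' n, b (n + N) ≤ ENNReal.ofReal (1 - Real.exp (-s))⁻¹ := by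
    rw [← tsum_geometric_of_lt_one (Real.exp_pos _).le hq1, ENNReal.ofReal_tsum_of_nonneg
      (fun n => by positivity) (summable_geometric_of_lt_one (Real.exp_pos _).le hq1)]
    refine ENNReal.tsum_le_tsum fun n => (hb _).trans (ENNReal.ofReal_le_ofReal ?_)
    rw [← Real.exp_nat_mul]
    refine Real.exp_le_exp.2 ?_
    push_cast
    linarith
  rw [ENNReal.ofReal_add (by positivity) (inv_nonneg.2 (by linarith))]
  exact add_le_add h1 h2

theorem _root_.Filter.Tendsto.average_congr_of_eventuallyEq {f g : ℕ → ℝ} {m : ℝ}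
    (hfg : f =ᶠ[atTop] g)
    (hf : Tendsto (fun n : ℕ => (∑ j ∈ Finset.range n, f j) / n) atTop (𝓝 m)) :
    Tendsto (fun n : ℕ => (∑ j ∈ Finset.range n, g j) / n) atTop (𝓝 m) := by
  obtain ⟨N, hN⟩ := eventually_atTop.1 hfg
  have h0 : Tendsto (fun n : ℕ => (∑ j ∈ Finset.range N, (g j - f j)) / n) atTop (𝓝 0) :=
    tendsto_const_nhds.div_atTop tendsto_natCast_atTop_atTop
  have := hf.add h0
  rw [add_zero] at this
  refine this.congr' ?_
  filter_upwards [eventually_ge_atTop N] with n hn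
  rw [← add_div]
  congr 1
  have : ∑ j ∈ Finset.range N, (g j - f j) = ∑ j ∈ Finset.range n, (g j - f j) := by
    refine Finset.sum_subset (Finset.range_mono hn) fun j _ hj => ?_
    rw [hN j (by simpa using hj), sub_self]
  rw [this, ← Finset.sum_add_distrib]
  exact Finset.sum_congr rfl fun j _ => by ring

/-- A path below the line c + rn needs at least (h - c)/r steps to reach `h`, and the change takes
away at most `c` of them. -/
theorem ofReal_le_alarmTime_sub {S : Type*} {F : S → ℝ} {y : ℕ → S} {t : ℕ∞} {c : ℕ} {r h : ℝ} (hr : 0 < r) (ht : t ≤ c)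
    (hy : ∀ n, cusum F y n ≤ c + r * n) :
    ENNReal.ofReal ((h - c) / r - c) ≤ ((alarmTime F y h - t : ℕ∞) : ℝ≥0∞) := by
  obtain ⟨k, rfl⟩ := ENat.ne_top_iff_exists.1 (ne_top_of_le_ne_top (ENat.natCast_ne_top c) ht)
  have hk : k ≤ c := Nat.cast_le.1 ht
  rcases eq_or_ne (alarmTime F y h) ⊤ with htop | hne
  · rw [htop]
    simp
  · obtain ⟨n, hn⟩ := ENat.ne_top_iff_exists.1 hne
    obtain ⟨m, hmn, hm⟩ := alarmTime_le_iff.1 hn.symm.le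
    have h1 : (h - c) / r ≤ m := by
      rw [div_le_iff₀' hr]
      linarith [hy m]
    have h2 : (m : ℝ) ≤ n := Nat.cast_le.2 hmn
    have h3 : (k : ℝ) ≤ c := Nat.cast_le.2 hk
    have h4 : (n : ℝ) - k ≤ (n - k : ℕ) := by
      rw [sub_le_iff_le_add]
      exact_mod_cast (by omega : n ≤ n - k + k)
    rw [← hn, ← ENat.natCast_sub, ENat.toENNReal_coe, ← ENNReal.ofReal_natCast]
    exact ENNReal.ofReal_le_ofReal (by linarith)

/-! ### Linear growth of the mean detection delay -/

section Delay

variable {Ω S : Type*} [MeasurableSpace Ω] [MeasurableSpace S] {P : Measure Ω}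
  {X₀ X₁ : ℕ → Ω → S} {τ : Ω → ℕ∞} {F : S → ℝ} {ϱ m₁ : ℝ}

theorem ae_tendsto_average_observation (indep₁ : iIndepFun X₁ P)
    (ident₁ : ∀ k, IdentDistrib (X₁ k) (X₁ 0) P P) (hτtop : ∀ᵐ ω ∂P, τ ω ≠ ⊤)
    (hF : Measurable F) (hint : Integrable (fun ω => F (X₁ 0 ω)) P) :
    ∀ᵐ ω ∂P, Tendsto (fun n : ℕ => (∑ j ∈ Finset.range n,
      F (observation (fun k => X₀ k ω) (fun k => X₁ k ω) (τ ω) (j + 1))) / n) atTop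
        (𝓝 (∫ ω, F (X₁ 0 ω) ∂P)) := by
  have hind : iIndepFun (fun k ω => F (X₁ (k + 1) ω)) P :=
    (indep₁.comp (fun _ => F) fun _ => hF).precomp (add_left_injective 1)
  have hid : ∀ k, IdentDistrib (fun ω => F (X₁ k ω)) (fun ω => F (X₁ 0 ω)) P P :=
    fun k => (ident₁ k).comp hF
  have hlaw := strong_law_ae_real (fun k ω => F (X₁ (k + 1) ω)) ((hid 1).integrable_iff.2 hint)
    (fun i j hij => hind.indepFun hij) fun i => (hid (i + 1)).trans (hid 1).symm
  filter_upwards [hlaw, hτtop] with ω hω hτω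
  rw [(hid (0 + 1)).integral_eq] at hω
  refine hω.average_congr_of_eventuallyEq ?_
  obtain ⟨k, hk⟩ := ENat.ne_top_iff_exists.1 hτω
  filter_upwards [eventually_ge_atTop k] with j hj
  rw [observation_eq_post]
  rw [← hk]
  exact Nat.cast_le.2 (by omega)

variable [IsProbabilityMeasure P]
-- On τ = k, a late alarm forces the `n` increments after `k` to sum to less than `h`. Their law
-- does not depend on `k`, and they are independent of `τ`, so the bound survives summation over
-- `k`.
theorem measure_add_lt_alarm_le (hX₁ : ∀ k, Measurable (X₁ k))
    (indep₁ : iIndepFun X₁ P) (ident₁ : ∀ k, IdentDistrib (X₁ k) (X₁ 0) P P)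
    (hτ : Measurable τ) (indepτ₁ : IndepFun (fun ω k => X₁ k ω) τ P) (hF : Measurable F) {t : ℝ}
    (ht : 0 ≤ t) (hi : Integrable (fun ω => Real.exp (-t * F (X₁ 0 ω))) P) (h : ℝ) (n : ℕ) :
    P {ω | τ ω + n < alarm X₀ X₁ τ F h ω} ≤
      ENNReal.ofReal (Real.exp (t * h) * mgf (fun ω => F (X₁ 0 ω)) P (-t) ^ n) := by
  have hind : iIndepFun (fun k ω => F (X₁ k ω)) P := indep₁.comp (fun _ => F) fun _ => hF
  have hid : ∀ k, IdentDistrib (fun ω => F (X₁ k ω)) (fun ω => F (X₁ 0 ω)) P P :=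
    fun k => (ident₁ k).comp hF
  set B := ENNReal.ofReal (Real.exp (t * h) * mgf (fun ω => F (X₁ 0 ω)) P (-t) ^ n)
  have hsub : {ω | τ ω + n < alarm X₀ X₁ τ F h ω} ⊆
      ⋃ k : ℕ, ({ω | ∑ j ∈ Finset.Ico (k + 1) (k + 1 + n), F (X₁ j ω) < h} ∩
        τ ⁻¹' {(k : ℕ∞)}) := by
    intro ω hω
    have hω' : τ ω + n < alarm X₀ X₁ τ F h ω := hω
    have hne : τ ω ≠ ⊤ := by
      intro hc
      rw [hc] at hω'
      simp at hω'
    obtain ⟨k, hk⟩ := ENat.ne_top_iff_exists.1 hne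
    refine Set.mem_iUnion.2 ⟨k, ?_, hk.symm⟩
    rw [alarm, ← hk] at hω'
    rw [Set.mem_ofPred_eq, Finset.sum_Ico_eq_sum_range, Nat.add_sub_cancel_left]
    exact sum_lt_of_add_lt_alarmTime_observation (x₀ := fun k => X₀ k ω)
      (x₁ := fun k => X₁ k ω) (by push_cast; exact hω')
  have hk : ∀ k : ℕ, P ({ω | ∑ j ∈ Finset.Ico (k + 1) (k + 1 + n), F (X₁ j ω) < h} ∩
        τ ⁻¹' {(k : ℕ∞)}) ≤ B * P (τ ⁻¹' {(k : ℕ∞)}) := fun k => by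
    have := indepτ₁.measure_inter_preimage_eq_mul
      {x : ℕ → S | ∑ j ∈ Finset.Ico (k + 1) (k + 1 + n), F (x j) < h} {(k : ℕ∞)}
      (measurableSet_lt (Finset.measurable_fun_sum _ fun j _ =>
        hF.comp (measurable_pi_apply j)) measurable_const) MeasurableSet.of_discrete
    refine (le_of_eq this).trans (mul_le_mul_left ?_ _)
    rw [← ofReal_measureReal]
    refine ENNReal.ofReal_le_ofReal ?_
    have hb := measureReal_sum_le_le hind (fun k => hF.comp (hX₁ k)) hid
      (Finset.Ico (k + 1) (k + 1 + n)) ht hi h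
    rw [Nat.card_Ico, Nat.add_sub_cancel_left] at hb
    refine (measureReal_mono (fun ω hω => ?_) (measure_ne_top _ _)).trans hb
    exact le_of_lt (show ∑ j ∈ Finset.Ico (k + 1) (k + 1 + n), F (X₁ j ω) < h from hω)
  calc P {ω | τ ω + n < alarm X₀ X₁ τ F h ω}
      ≤ ∑' k : ℕ, B * P (τ ⁻¹' {(k : ℕ∞)}) :=
        (measure_mono hsub).trans ((measure_iUnion_le _).trans (ENNReal.tsum_le_tsum hk))
    _ = B * P (⋃ k : ℕ, τ ⁻¹' {(k : ℕ∞)}) := by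
        rw [ENNReal.tsum_mul_left, measure_iUnion]
        · intro i j hij
          refine Disjoint.preimage τ (Set.disjoint_singleton.2 fun h => hij ?_)
          exact Nat.cast_injective h
        · exact fun k => hτ MeasurableSet.of_discrete
    _ ≤ B := mul_le_of_le_one_right' prob_le_one

theorem exists_MDD_le (hX₀ : ∀ k, Measurable (X₀ k)) (hX₁ : ∀ k, Measurable (X₁ k))
    (hτ : Measurable τ) (indep₁ : iIndepFun X₁ P)
    (ident₁ : ∀ k, IdentDistrib (X₁ k) (X₁ 0) P P) (indepτ₁ : IndepFun (fun ω k => X₁ k ω) τ P)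
    (hF : Measurable F) (m₁_def : m₁ = ∫ ω, F (X₁ 0 ω) ∂P) (hm₁ : 0 < m₁)
    (hint : 0 ∈ interior (integrableExpSet (fun ω => F (X₁ 0 ω)) P)) {ε : ℝ} (hε : 0 < ε) :
    ∃ K : ℝ, 0 ≤ K ∧ ∀ h : ℝ, 0 ≤ h →
      MDD P X₀ X₁ τ F h ≤ ENNReal.ofReal (h * (1 / m₁ + ε) + K) := by
  obtain ⟨m', hm'0, hm'1, hm'⟩ : ∃ m', 0 < m' ∧ m' < m₁ ∧ 1 / m' = 1 / m₁ + ε := by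
    have h1 : 1 / m₁ < 1 / m₁ + ε := by linarith
    have h0 : 0 < 1 / m₁ := by positivity
    refine ⟨1 / (1 / m₁ + ε), by positivity, ?_, by simp⟩
    simpa using one_div_lt_one_div_of_lt h0 h1
  set M := mgf (fun ω => F (X₁ 0 ω)) P with hM
  have hd : HasDerivAt M m₁ 0 := by
    have := hasDerivAt_mgf hint
    simpa [← m₁_def] using this
  -- The slope at 0 is m' - m₁ < 0, so M(-t) < e^(-tm') for some small t > 0.
  have d1 : HasDerivAt (fun t => M (-t) * Real.exp (t * m')) (m' - m₁) 0 := by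
    have e1 : HasDerivAt (fun t : ℝ => Real.exp (t * m')) m' 0 := by
      simpa using ((hasDerivAt_id (0 : ℝ)).mul_const m').exp
    have e2 : HasDerivAt (fun t : ℝ => M (-t)) (-m₁) 0 := by
      simpa using HasDerivAt.comp_const_sub (f := M) (f' := m₁) 0 0 (by simpa using hd)
    refine (e2.mul e1).congr_deriv ?_
    simp [hM]; ring
  have i1 : ∀ᶠ t : ℝ in 𝓝[>] 0, -t ∈ integrableExpSet (fun ω => F (X₁ 0 ω)) P := by
    refine Filter.Eventually.filter_mono nhdsWithin_le_nhds ?_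
    have : Tendsto (fun t : ℝ => -t) (𝓝 0) (𝓝 0) :=
      Continuous.tendsto' (by fun_prop) _ _ (by simp)
    exact this.eventually (mem_interior_iff_mem_nhds.1 hint)
  obtain ⟨t, ht0, ht1, hti⟩ := ((eventually_mem_nhdsWithin (a := (0 : ℝ)) (s := Set.Ioi 0)).and
    ((d1.eventually_lt_right (by linarith)).and i1)).exists
  have ht : 0 < t := ht0
  have hMt : M (-t) ≤ Real.exp (-(t * m')) := by
    rw [Real.exp_neg, ← one_div, le_div_iff₀ (Real.exp_pos _)]
    simpa [hM, mgf_zero] using ht1.le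
  have hs : 0 < t * m' := by positivity
  have hq1 : Real.exp (-(t * m')) < 1 := Real.exp_lt_one_iff.2 (by linarith)
  refine ⟨1 + (1 - Real.exp (-(t * m')))⁻¹,
    add_nonneg zero_le_one (inv_nonneg.2 (by linarith)), fun h hh => ?_⟩
  have ha := measurable_alarm hF hX₀ hX₁ hτ h
  have hset : ∀ n : ℕ, MeasurableSet {ω | τ ω + n < alarm X₀ X₁ τ F h ω} := fun n =>
    (hτ.prodMk ha) (MeasurableSet.of_discrete (s := {p : ℕ∞ × ℕ∞ | p.1 + n < p.2}))
  have hind : ∀ (n : ℕ) (ω : Ω),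
      ({n : ℕ | (n : ℕ∞) < alarm X₀ X₁ τ F h ω - τ ω}.indicator 1 n : ℝ≥0∞) =
      {ω | τ ω + n < alarm X₀ X₁ τ F h ω}.indicator 1 ω := fun n ω => by
    simp only [Set.indicator, Set.mem_ofPred_eq, lt_tsub_iff_left, Pi.one_apply]
  unfold MDD
  simp only [ENat.toENNReal_eq_tsum, hind]
  rw [lintegral_tsum fun n => (measurable_one.indicator (hset n)).aemeasurable]
  simp only [lintegral_indicator_one (hset _)]
  refine (ENNReal.tsum_le_of_geometric (A := t * h) (s := t * m') (by positivity) hs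
    (fun n => prob_le_one) fun n => ?_).trans_eq ?_
  · refine (measure_add_lt_alarm_le hX₁ indep₁ ident₁ hτ indepτ₁ hF ht.le hti h n).trans
      (ENNReal.ofReal_le_ofReal ?_)
    rw [sub_eq_add_neg, Real.exp_add, show -(t * m' * n) = n * -(t * m') by ring, Real.exp_nat_mul]
    exact mul_le_mul_of_nonneg_left (pow_le_pow_left₀ mgf_nonneg hMt _) (Real.exp_pos _).le
  · rw [← hm', mul_div_mul_left _ _ ht.ne', add_assoc, mul_one_div]

theorem RegularGeometricTail.ae_ne_top (hϱ : 0 < ϱ) (tail : RegularGeometricTail P τ ϱ) :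
    ∀ᵐ ω ∂P, τ ω ≠ ⊤ := by
  obtain ⟨r, hr0, hr⟩ := exists_between hϱ
  obtain ⟨C, -, hC⟩ := tail.exists_le hr0.le hr
  have hle : ∀ n : ℕ, P.real {ω | τ ω = ⊤} ≤ C * Real.exp (-(r * n)) := fun n =>
    (measureReal_mono fun ω (hω : τ ω = ⊤) => by
      simp [hω]).trans (hC n)
  have hlim : Tendsto (fun n : ℕ => C * Real.exp (-(r * n))) atTop (𝓝 (C * 0)) :=
    (Real.tendsto_exp_neg_atTop_nhds_zero.comp
      (tendsto_natCast_atTop_atTop.const_mul_atTop hr0)).const_mul C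
  rw [mul_zero] at hlim
  have h0 : P.real {ω | τ ω = ⊤} = 0 :=
    le_antisymm (ge_of_tendsto' hlim hle) measureReal_nonneg
  rw [ae_iff]
  simpa [measureReal_eq_zero_iff] using h0

/-- Almost every path stays below some line of slope r > m₁. A single intercept serves with
probability above 1 - η, and Markov's inequality on that event gives the bound. -/
theorem exists_le_MDD (hX₀ : ∀ k, Measurable (X₀ k)) (hX₁ : ∀ k, Measurable (X₁ k))
    (hτ : Measurable τ) (indep₁ : iIndepFun X₁ P)
    (ident₁ : ∀ k, IdentDistrib (X₁ k) (X₁ 0) P P) (hτtop : ∀ᵐ ω ∂P, τ ω ≠ ⊤)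
    (hF : Measurable F) (m₁_def : m₁ = ∫ ω, F (X₁ 0 ω) ∂P) (hm₁ : 0 < m₁)
    {ε : ℝ} (hε : 0 < ε) :
    ∃ K : ℝ, 0 ≤ K ∧ ∀ h : ℝ, 0 ≤ h →
      ENNReal.ofReal (h * (1 / m₁ - ε) - K) ≤ MDD P X₀ X₁ τ F h := by
  have hint : Integrable (fun ω => F (X₁ 0 ω)) P := by
    by_contra hc
    rw [integral_undef hc] at m₁_def
    exact hm₁.ne' m₁_def
  obtain ⟨η, hη, hη1, hηε⟩ : ∃ η : ℝ, 0 < η ∧ η < 1 ∧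
      1 / m₁ - ε < (1 - η) / (m₁ * (1 + η)) := by
    obtain ⟨η, h1, h2, h3⟩ := exists_pos_lt_and_lt (f := fun η => -((1 - η) / (m₁ * (1 + η))))
      (a := -(1 / m₁ - ε)) (ContinuousAt.neg (ContinuousAt.div (by fun_prop) (by fun_prop)
        (by simpa using hm₁.ne'))) (by simp only [sub_zero, add_zero, mul_one]; linarith)
      zero_lt_one
    exact ⟨η, h1, h2, neg_lt_neg_iff.1 h3⟩
  set r := m₁ * (1 + η) with hr
  have hrm : m₁ < r := by rw [hr]; nlinarith
  have hr0 : 0 < r := hm₁.trans hrm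
  set Y : Ω → ℕ → S := fun ω => observation (fun k => X₀ k ω) (fun k => X₁ k ω) (τ ω) with hY
  -- One integer bounds both the change time and the intercept, so these events increase in `c`.
  set A : ℕ → Set Ω := fun c => {ω | τ ω ≤ c ∧ ∀ n : ℕ, cusum F (Y ω) n ≤ c + r * n} with hA
  have hmono : Monotone A := fun c d hcd ω hω =>
    ⟨hω.1.trans (Nat.cast_le.2 hcd), fun n => (hω.2 n).trans
      (add_le_add_left (Nat.cast_le.2 hcd) _)⟩
  have hfull : P (⋃ c, A c) = 1 := by
    refine (measure_congr (eventuallyEq_univ.2 ?_)).trans measure_univ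
    filter_upwards [ae_tendsto_average_observation (X₀ := X₀) indep₁ ident₁ hτtop hF hint,
      hτtop] with ω hω hτω
    rw [← m₁_def] at hω
    obtain ⟨c, hc⟩ := exists_cusum_le hm₁ hrm hω
    obtain ⟨k, hk⟩ := ENat.ne_top_iff_exists.1 hτω
    refine Set.mem_iUnion.2 ⟨max k ⌈c⌉₊, ?_, fun n => (hc n).trans (add_le_add_left ?_ _)⟩
    · rw [← hk]
      exact Nat.cast_le.2 (le_max_left _ _)
    · exact (Nat.le_ceil c).trans (Nat.cast_le.2 (le_max_right _ _))
  have hlim := tendsto_measure_iUnion_atTop (μ := P) hmono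
  rw [hfull] at hlim
  obtain ⟨c, hc⟩ := (hlim.eventually (lt_mem_nhds (show ENNReal.ofReal (1 - η) < 1 by
    rw [← ENNReal.ofReal_one]
    exact (ENNReal.ofReal_lt_ofReal_iff zero_lt_one).2 (by linarith)))).exists
  refine ⟨(1 - η) * (c / r + c), mul_nonneg (by linarith) (by positivity), fun h hh => ?_⟩
  have hmeas : Measurable fun ω => ((alarm X₀ X₁ τ F h ω - τ ω : ℕ∞) : ℝ≥0∞) :=
    (Measurable.of_discrete (f := fun p : ℕ∞ × ℕ∞ => ((p.1 - p.2 : ℕ∞) : ℝ≥0∞))).comp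
      ((measurable_alarm hF hX₀ hX₁ hτ h).prodMk hτ)
  calc ENNReal.ofReal (h * (1 / m₁ - ε) - (1 - η) * (c / r + c))
      ≤ ENNReal.ofReal (((h - c) / r - c) * (1 - η)) := by
        refine ENNReal.ofReal_le_ofReal ?_
        have := mul_le_mul_of_nonneg_left hηε.le hh
        have e : ((h - c) / r - c) * (1 - η) = h * ((1 - η) / r) - (1 - η) * (c / r + c) := by
          ring
        linarith
    _ = ENNReal.ofReal ((h - c) / r - c) * ENNReal.ofReal (1 - η) :=
        ENNReal.ofReal_mul' (by linarith)
    _ ≤ ENNReal.ofReal ((h - c) / r - c) * P {ω | ENNReal.ofReal ((h - c) / r - c) ≤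
          ((alarm X₀ X₁ τ F h ω - τ ω : ℕ∞) : ℝ≥0∞)} := by
        refine mul_le_mul_right (hc.le.trans (measure_mono fun ω hω => ?_)) _
        exact ofReal_le_alarmTime_sub hr0 hω.1 hω.2
    _ ≤ MDD P X₀ X₁ τ F h := mul_meas_ge_le_lintegral hmeas _

end Delay

/-! ### Deterministic trade-off between linear delay and exponential eagerness -/

theorem eventually_le_mul_atTop {c : ℝ} (hc : 0 < c) (K : ℝ) : ∀ᶠ L : ℝ in atTop, K ≤ c * L :=
  (tendsto_id.const_mul_atTop hc).eventually_ge_atTop K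

theorem eventually_mul_lt_mul_exp {c K : ℝ} (hc : 0 < c) (hK : 0 < K) (C : ℝ) :
    ∀ᶠ L : ℝ in atTop, C * L < K * Real.exp (c * L) := by
  have hd : 0 < K * c ^ 2 / 2 := by positivity
  filter_upwards [eventually_le_mul_atTop hd C, eventually_gt_atTop 0] with L hL hL0
  have h1 := Real.quadratic_le_exp_of_nonneg (mul_pos hc hL0).le
  have h2 : K * (1 + c * L + (c * L) ^ 2 / 2) ≤ K * Real.exp (c * L) :=
    mul_le_mul_of_nonneg_left h1 hK.le
  have h3 : C * L ≤ K * c ^ 2 / 2 * L * L := mul_le_mul_of_nonneg_right hL hL0.le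
  have h4 : 0 < K * (1 + c * L) := by positivity
  linarith

section Tradeoff

variable {D E : ℝ → ℝ} {a v : ℝ}

theorem tendsto_div_sub_of_linear_bounds
    (hD₁ : ∀ ε > 0, ∃ K, 0 ≤ K ∧ ∀ h, 0 ≤ h → D h ≤ h * (a + ε) + K)
    (hD₂ : ∀ ε > 0, ∃ K, 0 ≤ K ∧ ∀ h, 0 ≤ h → h * (a - ε) - K ≤ D h) :
    Tendsto (fun h => D h / h - a) atTop (𝓝 0) := by
  refine NormedAddGroup.tendsto_nhds_zero.2 fun ε hε => ?_
  obtain ⟨K₁, -, hK₁⟩ := hD₁ (ε / 3) (by linarith)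
  obtain ⟨K₂, -, hK₂⟩ := hD₂ (ε / 3) (by linarith)
  have h3 : 0 < ε / 3 := by linarith
  filter_upwards [eventually_le_mul_atTop h3 K₁, eventually_le_mul_atTop h3 K₂,
    eventually_gt_atTop 0] with h e1 e2 h0
  have b1 := hK₁ h h0.le
  have b2 := hK₂ h h0.le
  have hεh : 0 < ε * h := by positivity
  rw [Real.norm_eq_abs, abs_lt]
  constructor
  · rw [lt_sub_iff_add_lt, lt_div_iff₀ h0]
    linarith
  · rw [sub_lt_iff_lt_add, div_lt_iff₀ h0]
    linarith

theorem tendsto_neg_log_div_sub_of_exp_bounds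
    (hE₁ : ∀ ε > 0, ∃ K, 0 < K ∧ ∀ h, 0 ≤ h → E h ≤ K * Real.exp (-((v - ε) * h)))
    (hE₂ : ∀ ε > 0, ∃ K, 0 < K ∧ ∀ h, 0 ≤ h → K * Real.exp (-((v + ε) * h)) ≤ E h) :
    Tendsto (fun h => -Real.log (E h) / h - v) atTop (𝓝 0) := by
  refine tendsto_div_sub_of_linear_bounds (D := fun h => -Real.log (E h)) ?_ ?_
  · intro ε hε
    obtain ⟨K, hK, hKh⟩ := hE₂ ε hε
    refine ⟨|Real.log K|, abs_nonneg _, fun h hh => ?_⟩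
    have := Real.log_le_log (by positivity) (hKh h hh)
    rw [Real.log_mul hK.ne' (Real.exp_pos _).ne', Real.log_exp] at this
    linarith [neg_abs_le (Real.log K)]
  · intro ε hε
    obtain ⟨K, hK, hKh⟩ := hE₁ ε hε
    -- The lower bound is needed here only for positivity of `E h`, so that logarithms are monotone.
    obtain ⟨K', hK', hKh'⟩ := hE₂ ε hε
    refine ⟨|Real.log K|, abs_nonneg _, fun h hh => ?_⟩
    have := Real.log_le_log (lt_of_lt_of_le (by positivity) (hKh' h hh)) (hKh h hh)
    rw [Real.log_mul hK.ne' (Real.exp_pos _).ne', Real.log_exp] at this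
    linarith [le_abs_self (Real.log K)]

theorem eventually_exists_cost_le (hv : 0 < v)
    (hD₁ : ∀ ε > 0, ∃ K, 0 ≤ K ∧ ∀ h, 0 ≤ h → D h ≤ h * (a + ε) + K)
    (hE₁ : ∀ ε > 0, ∃ K, 0 < K ∧ ∀ h, 0 ≤ h → E h ≤ K * Real.exp (-((v - ε) * h)))
    {ε : ℝ} (hε : 0 < ε) :
    ∀ᶠ L : ℝ in atTop, ∃ h, 0 ≤ h ∧ D h + Real.exp L * E h ≤ (a * (1 / v) + ε) * L := by
  obtain ⟨δ, hδ, hδv, hδε⟩ := exists_pos_lt_and_lt (f := fun δ => (a + δ) / (v - δ))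
    (a := a * (1 / v) + ε / 2) (ContinuousAt.div (by fun_prop) (by fun_prop) (by simpa using hv.ne'))
    (by simp only [add_zero, sub_zero, mul_one_div]; linarith) hv
  obtain ⟨K₁, hK₁0, hK₁⟩ := hD₁ δ hδ
  obtain ⟨K₂, hK₂0, hK₂⟩ := hE₁ δ hδ
  have hvδ : 0 < v - δ := by linarith
  filter_upwards [eventually_le_mul_atTop (half_pos hε) (K₁ + K₂), eventually_gt_atTop 0]
    with L hL hL0
  have hh : 0 ≤ L / (v - δ) := by positivity
  -- At this threshold the bound on the eagerness term is exactly the constant `K₂`.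
  refine ⟨L / (v - δ), hh, ?_⟩
  have h1 := hK₁ _ hh
  have h2 := mul_le_mul_of_nonneg_left (hK₂ _ hh) (Real.exp_pos L).le
  rw [mul_div_cancel₀ _ hvδ.ne', mul_left_comm, ← Real.exp_add, add_neg_cancel, Real.exp_zero,
    mul_one] at h2
  have h3 : L / (v - δ) * (a + δ) ≤ (a * (1 / v) + ε / 2) * L := by
    rw [div_mul_eq_mul_div, mul_div_assoc, mul_comm]
    exact mul_le_mul_of_nonneg_right hδε.le hL0.le
  linarith

/-- For a smaller threshold the eagerness term is at least K e^(δL), which exceeds every multiple of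
L. -/
theorem eventually_le_of_cost_le (hv : 0 < v) (hD₀ : ∀ h, 0 ≤ h → 0 ≤ D h)
    (hE₂ : ∀ ε > 0, ∃ K, 0 < K ∧ ∀ h, 0 ≤ h → K * Real.exp (-((v + ε) * h)) ≤ E h)
    {ε : ℝ} (hε : 0 < ε) (C : ℝ) :
    ∀ᶠ L : ℝ in atTop, ∀ h, 0 ≤ h → D h + Real.exp L * E h ≤ C * L → (1 / v - ε) * L ≤ h := by
  obtain ⟨δ, hδ, -, hδε⟩ := exists_pos_lt_and_lt (f := fun δ => -((1 - δ) / (v + δ)))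
    (a := -(1 / v - ε)) (ContinuousAt.neg (ContinuousAt.div (by fun_prop) (by fun_prop)
      (by simpa using hv.ne'))) (by simp only [add_zero, sub_zero]; linarith) hv
  obtain ⟨K, hK0, hK⟩ := hE₂ δ hδ
  filter_upwards [eventually_mul_lt_mul_exp hδ hK0 C, eventually_gt_atTop 0] with L hL hL0 h hh hc
  by_contra! hlt
  have h1 : h < (1 - δ) / (v + δ) * L :=
    hlt.trans (mul_lt_mul_of_pos_right (neg_lt_neg_iff.1 hδε) hL0)
  rw [div_mul_eq_mul_div, lt_div_iff₀ (by positivity)] at h1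
  have h2 := mul_le_mul_of_nonneg_left (hK h hh) (Real.exp_pos L).le
  rw [mul_left_comm, ← Real.exp_add] at h2
  have h3 : K * Real.exp (δ * L) ≤ K * Real.exp (L + -((v + δ) * h)) :=
    mul_le_mul_of_nonneg_left (Real.exp_le_exp.2 (by linarith)) hK0.le
  linarith [hD₀ h hh]

/-- Either the cost already exceeds aL/v, or the threshold is nearly L/v and the delay alone costs
almost that much. -/
theorem eventually_le_cost (ha : 0 < a) (hv : 0 < v) (hD₀ : ∀ h, 0 ≤ h → 0 ≤ D h)
    (hE₀ : ∀ h, 0 ≤ h → 0 ≤ E h)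
    (hD₂ : ∀ ε > 0, ∃ K, 0 ≤ K ∧ ∀ h, 0 ≤ h → h * (a - ε) - K ≤ D h)
    (hE₂ : ∀ ε > 0, ∃ K, 0 < K ∧ ∀ h, 0 ≤ h → K * Real.exp (-((v + ε) * h)) ≤ E h)
    {ε : ℝ} (hε : 0 < ε) :
    ∀ᶠ L : ℝ in atTop, ∀ h, 0 ≤ h → (a * (1 / v) - ε) * L ≤ D h + Real.exp L * E h := by
  obtain ⟨δ, hδ, hδa, hδε⟩ := exists_pos_lt_and_lt (f := fun δ => -((1 / v - δ) * (a - δ)))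
    (a := -(a * (1 / v) - ε / 2)) (by fun_prop)
    (by simp only [sub_zero]; linarith) ha
  obtain ⟨K, hK0, hK⟩ := hD₂ δ hδ
  filter_upwards [eventually_le_of_cost_le hv hD₀ hE₂ hδ (a * (1 / v)),
    eventually_le_mul_atTop (half_pos hε) K, eventually_gt_atTop 0] with L hL hLK hL0 h hh
  rcases le_total (D h + Real.exp L * E h) (a * (1 / v) * L) with hc | hc
  · have h1 := mul_le_mul_of_nonneg_right (hL h hh hc) (sub_pos.2 hδa).le
    have h2 := mul_le_mul_of_nonneg_right (neg_lt_neg_iff.1 hδε).le hL0.le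
    have h3 := hK h hh
    have h4 := mul_nonneg (Real.exp_pos L).le (hE₀ h hh)
    have h5 : (1 / v - δ) * L * (a - δ) = (1 / v - δ) * (a - δ) * L := by ring
    linarith
  · have := mul_pos hε hL0
    linarith

/-- Thresholds with asymptotically optimal cost are asymptotically optimal. -/
theorem isLittleO_sub_log_of_cost_le (ha : 0 < a) (hv : 0 < v) (hD₀ : ∀ h, 0 ≤ h → 0 ≤ D h)
    (hE₀ : ∀ h, 0 ≤ h → 0 ≤ E h)
    (hD₂ : ∀ ε > 0, ∃ K, 0 ≤ K ∧ ∀ h, 0 ≤ h → h * (a - ε) - K ≤ D h)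
    (hE₂ : ∀ ε > 0, ∃ K, 0 < K ∧ ∀ h, 0 ≤ h → K * Real.exp (-((v + ε) * h)) ≤ E h)
    {hstar : ℝ → ℝ} (hnn : ∀ᶠ κ in atTop, 0 ≤ hstar κ)
    (hcost : ∀ ε > 0, ∀ᶠ κ in atTop,
      D (hstar κ) + κ * E (hstar κ) ≤ (a * (1 / v) + ε) * Real.log κ) :
    (fun κ => hstar κ - 1 / v * Real.log κ) =o[atTop] Real.log := by
  refine isLittleO_iff.2 fun ε hε => ?_
  -- For the upper bound, (a - δ)h - K ≤ D ≤ (a/v + δ) log κ; the second δ in the numerator absorbs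
  -- `K`.
  obtain ⟨δ, hδ, hδa, hδε⟩ := exists_pos_lt_and_lt (f := fun δ => (a * (1 / v) + 2 * δ) / (a - δ))
    (a := 1 / v + ε) (ContinuousAt.div (by fun_prop) (by fun_prop) (by simpa using ha.ne'))
    (by simp only [sub_zero, mul_zero, add_zero, mul_div_cancel_left₀ _ ha.ne']; linarith) ha
  obtain ⟨K, hK0, hK⟩ := hD₂ δ hδ
  filter_upwards [hnn, hcost δ hδ,
    Real.tendsto_log_atTop.eventually (eventually_le_of_cost_le hv hD₀ hE₂ hε (a * (1 / v) + δ)),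
    Real.tendsto_log_atTop.eventually (eventually_le_mul_atTop hδ K),
    Real.tendsto_log_atTop.eventually (eventually_gt_atTop 0), eventually_gt_atTop 0]
    with κ h0 hc hlow hκK hL0 hκ0
  rw [Real.exp_log hκ0] at hlow
  have h1 := hlow _ h0 hc
  have h2 := hK _ h0
  have h3 := mul_nonneg hκ0.le (hE₀ _ h0)
  have h4 : hstar κ ≤ (1 / v + ε) * Real.log κ := by
    refine le_trans ?_ (mul_le_mul_of_nonneg_right hδε.le hL0.le)
    rw [div_mul_eq_mul_div, le_div_iff₀ (sub_pos.2 hδa)]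
    linarith
  rw [Real.norm_eq_abs, Real.norm_eq_abs, abs_of_pos hL0, abs_le]
  constructor <;> linarith

end Tradeoff

section Thresholds

variable {Ω S : Type*} [MeasurableSpace Ω] {P : Measure Ω} {X₀ X₁ : ℕ → Ω → S} {τ : Ω → ℕ∞}
  {F : S → ℝ} {h κ δ : ℝ}

theorem optCost_le_cost (hh : 0 ≤ h) : optCost P X₀ X₁ τ F κ ≤ cost P X₀ X₁ τ F h κ :=
  iInf₂_le h hh

theorem optThresholds_subset_nearOptThresholds :
    optThresholds P X₀ X₁ τ F κ ⊆ nearOptThresholds P X₀ X₁ τ F δ κ :=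
  fun _ hh => ⟨hh.1, (le_iInf₂ hh.2).trans le_self_add⟩

theorem cost_ne_top (hD : MDD P X₀ X₁ τ F h ≠ ⊤) (hE : MDE P X₀ X₁ τ F h ≠ ⊤) :
    cost P X₀ X₁ τ F h κ ≠ ⊤ :=
  ENNReal.add_ne_top.2 ⟨hD, ENNReal.mul_ne_top ENNReal.ofReal_ne_top hE⟩

theorem toReal_cost (hD : MDD P X₀ X₁ τ F h ≠ ⊤) (hE : MDE P X₀ X₁ τ F h ≠ ⊤) (hκ : 0 ≤ κ) :
    (cost P X₀ X₁ τ F h κ).toReal =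
      (MDD P X₀ X₁ τ F h).toReal + κ * (MDE P X₀ X₁ τ F h).toReal := by
  rw [cost, ENNReal.toReal_add hD (ENNReal.mul_ne_top ENNReal.ofReal_ne_top hE),
    ENNReal.toReal_mul, ENNReal.toReal_ofReal hκ]

end Thresholds

end QCD

/-! ### The main theorem -/

theorem mainTheorem1 {Ω S : Type*} [MeasurableSpace Ω] [MeasurableSpace S]
    (P : Measure Ω) [IsProbabilityMeasure P]
    -- the conditionally i.i.d. model
    (X₀ X₁ : ℕ → Ω → S) (τ : Ω → ℕ∞)
    (hX₀ : ∀ k, Measurable (X₀ k)) (hX₁ : ∀ k, Measurable (X₁ k)) (hτ : Measurable τ)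
    (indep₀ : iIndepFun X₀ P) (ident₀ : ∀ k, IdentDistrib (X₀ k) (X₀ 0) P P)
    (indep₁ : iIndepFun X₁ P) (ident₁ : ∀ k, IdentDistrib (X₁ k) (X₁ 0) P P)
    (indepτ₀ : IndepFun (fun ω k => X₀ k ω) τ P)
    (indepτ₁ : IndepFun (fun ω k => X₁ k ω) τ P)
    -- the statistic, with negative mean before and positive mean after the change
    (F : S → ℝ) (hF : Measurable F)
    (m₀ m₁ : ℝ) (m₀_def : m₀ = ∫ ω, F (X₀ 0 ω) ∂P) (m₁_def : m₁ = ∫ ω, F (X₁ 0 ω) ∂P)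
    (hm₀ : m₀ < 0) (hm₁ : 0 < m₁)
    -- the change time has a regular geometric tail with positive rate
    (ϱ : ℝ) (hϱ : 0 < ϱ) (tail : QCD.RegularGeometricTail P τ ϱ)
    -- the pre-change log moment generating function
    (υ₀ υp : ℝ) (hυ₀ : υ₀ ≠ 0)
    (roots : {υ : ℝ | QCD.logMGF P (fun ω => F (X₀ 0 ω)) υ = 0} = {0, υ₀})
    (hυp : {υ : ℝ | υ₀ < υ ∧ QCD.logMGF P (fun ω => F (X₀ 0 ω)) υ = (ϱ : EReal)} = {υp})
    (finite₀ : ∀ᶠ υ in 𝓝ˢ (Set.Icc 0 υp), QCD.logMGF P (fun ω => F (X₀ 0 ω)) υ ≠ ⊤)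
    -- the post-change log moment generating function
    (finite₁ : ∀ᶠ υ in 𝓝 (0 : ℝ), QCD.logMGF P (fun ω => F (X₁ 0 ω)) υ ≠ ⊤) :
    -- approximation of the cost; the error terms depend on the threshold only
    (∃ ε₁ ε₂ : ℝ → ℝ, Tendsto ε₁ atTop (𝓝 0) ∧ Tendsto ε₂ atTop (𝓝 0) ∧
      ∀ h κ : ℝ, 0 < h → 0 < κ →
        QCD.cost P X₀ X₁ τ F h κ ≠ ⊤ ∧
        (QCD.cost P X₀ X₁ τ F h κ).toReal =
          h * (1 / m₁ + ε₁ h) + κ * Real.exp (-(h * (υp + ε₂ h)))) ∧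
    -- optimal thresholds
    (∀ hstar : ℝ → ℝ, (∀ᶠ κ in atTop, hstar κ ∈ QCD.optThresholds P X₀ X₁ τ F κ) →
      (fun κ => hstar κ - 1 / υp * Real.log κ) =o[atTop] Real.log) ∧
    -- thresholds that are optimal up to a constant (these always exist if the constant is positive)
    (∀ δ : ℝ, 0 < δ → ∀ hstar : ℝ → ℝ,
      (∀ᶠ κ in atTop, hstar κ ∈ QCD.nearOptThresholds P X₀ X₁ τ F δ κ) →
      (fun κ => hstar κ - 1 / υp * Real.log κ) =o[atTop] Real.log) ∧
    -- optimal cost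
    (∀ᶠ κ in atTop, QCD.optCost P X₀ X₁ τ F κ ≠ ⊤) ∧
    (fun κ => (QCD.optCost P X₀ X₁ τ F κ).toReal - 1 / m₁ * (1 / υp) * Real.log κ)
      =o[atTop] Real.log := by 
  have hZ₀ : Measurable fun ω => F (X₀ 0 ω) := hF.comp (hX₀ 0)
  have hZ₁ : Measurable fun ω => F (X₁ 0 ω) := hF.comp (hX₁ 0)
  -- the pre-change moment generating function
  have hυ₀root : QCD.logMGF P (fun ω => F (X₀ 0 ω)) υ₀ = ((0 : ℝ) : EReal) := by
    have : υ₀ ∈ ({0, υ₀} : Set ℝ) := by simp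
    rw [← roots] at this
    exact this
  have hυpmem : υ₀ < υp ∧ QCD.logMGF P (fun ω => F (X₀ 0 ω)) υp = (ϱ : EReal) := by
    have : υp ∈ ({υp} : Set ℝ) := rfl
    rw [← hυp] at this
    exact this
  obtain ⟨hlt, hυproot⟩ := hυpmem
  have hM₀ := QCD.mgf_eq_exp_of_logMGF_eq hZ₀ hυ₀root
  have hMp := QCD.mgf_eq_exp_of_logMGF_eq hZ₀ hυproot
  have hi₀ := QCD.integrable_exp_of_logMGF_ne_top (P := P) hZ₀ (v := υ₀)
    (by rw [hυ₀root]; exact EReal.coe_ne_top 0)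
  have hip := QCD.integrable_exp_of_logMGF_ne_top (P := P) hZ₀ (v := υp)
    (by rw [hυproot]; exact EReal.coe_ne_top ϱ)
  rw [Real.exp_zero] at hM₀
  -- The negative mean makes the moment generating function exceed 1 on the negative axis, so the
  -- nonzero root is positive.
  have hυ₀pos : 0 < υ₀ := by
    rcases lt_or_gt_of_ne hυ₀ with hneg | hpos
    · exact absurd hM₀ (QCD.one_lt_mgf_of_integral_neg (m₀_def ▸ hm₀) hneg hi₀).ne'
    · exact hpos
  have hυppos : 0 < υp := hυ₀pos.trans hlt
  have hint₀ : υp ∈ interior (integrableExpSet (fun ω => F (X₀ 0 ω)) P) :=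
    QCD.mem_interior_integrableExpSet hZ₀
      (finite₀.filter_mono (nhds_le_nhdsSet (Set.right_mem_Icc.2 hυppos.le)))
  have hint₁ := QCD.mem_interior_integrableExpSet hZ₁ finite₁
  -- bounds on the two components of the cost
  have hDfin : ∀ h, 0 ≤ h → QCD.MDD P X₀ X₁ τ F h ≠ ⊤ := fun h hh => by
    obtain ⟨K, -, hK⟩ := QCD.exists_MDD_le hX₀ hX₁ hτ indep₁ ident₁ indepτ₁ hF m₁_def hm₁ hint₁
      zero_lt_one
    exact ne_top_of_le_ne_top ENNReal.ofReal_ne_top (hK h hh)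
  have hD₁ : ∀ ε > 0, ∃ K, 0 ≤ K ∧ ∀ h, 0 ≤ h →
      (QCD.MDD P X₀ X₁ τ F h).toReal ≤ h * (1 / m₁ + ε) + K := fun ε hε => by
    obtain ⟨K, hK0, hK⟩ := QCD.exists_MDD_le hX₀ hX₁ hτ indep₁ ident₁ indepτ₁ hF m₁_def hm₁ hint₁ hε
    refine ⟨K, hK0, fun h hh => ENNReal.toReal_le_of_le_ofReal ?_ (hK h hh)⟩
    positivity
  have hD₂ : ∀ ε > 0, ∃ K, 0 ≤ K ∧ ∀ h, 0 ≤ h →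
      h * (1 / m₁ - ε) - K ≤ (QCD.MDD P X₀ X₁ τ F h).toReal := fun ε hε => by
    obtain ⟨K, hK0, hK⟩ := QCD.exists_le_MDD hX₀ hX₁ hτ indep₁ ident₁ (tail.ae_ne_top hϱ) hF m₁_def
      hm₁ hε
    exact ⟨K, hK0, fun h hh => (ENNReal.ofReal_le_iff_le_toReal (hDfin h hh)).1 (hK h hh)⟩
  have hE₁' : ∀ ε > 0, ∃ K, 0 < K ∧ ∀ h, 0 ≤ h →
      QCD.MDE P X₀ X₁ τ F h ≤ ENNReal.ofReal (K * Real.exp (-((υp - ε) * h))) := fun ε hε => by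
    obtain ⟨u, hu1, hu2⟩ := exists_between (max_lt hlt (sub_lt_self υp hε))
    have hu₀ : υ₀ < u := (le_max_left _ _).trans_lt hu1
    have hi := integrable_exp_mul_of_le_of_le hi₀ hip hu₀.le hu2.le
    have hMu := QCD.mgf_lt_of_mem_Ioo hi₀ hip hu₀ hu2 hM₀ hMp (Real.one_lt_exp_iff.2 hϱ)
    obtain ⟨K, hK0, hK⟩ := QCD.exists_MDE_le hX₀ hX₁ hτ indep₀ ident₀ indepτ₀ hF hϱ tail
      (hυ₀pos.trans hu₀).le hi hMu
    refine ⟨K, hK0, fun h hh => (hK h).trans (ENNReal.ofReal_le_ofReal ?_)⟩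
    refine mul_le_mul_of_nonneg_left (Real.exp_le_exp.2 (neg_le_neg ?_)) hK0.le
    exact mul_le_mul_of_nonneg_right ((le_max_right _ _).trans hu1.le) hh
  have hEfin : ∀ h, 0 ≤ h → QCD.MDE P X₀ X₁ τ F h ≠ ⊤ := fun h hh => by
    obtain ⟨K, -, hK⟩ := hE₁' 1 zero_lt_one
    exact ne_top_of_le_ne_top ENNReal.ofReal_ne_top (hK h hh)
  have hE₁ : ∀ ε > 0, ∃ K, 0 < K ∧ ∀ h, 0 ≤ h →
      (QCD.MDE P X₀ X₁ τ F h).toReal ≤ K * Real.exp (-((υp - ε) * h)) := fun ε hε => by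
    obtain ⟨K, hK0, hK⟩ := hE₁' ε hε
    exact ⟨K, hK0, fun h hh => ENNReal.toReal_le_of_le_ofReal (by positivity) (hK h hh)⟩
  have hE₂ : ∀ ε > 0, ∃ K, 0 < K ∧ ∀ h, 0 ≤ h →
      K * Real.exp (-((υp + ε) * h)) ≤ (QCD.MDE P X₀ X₁ τ F h).toReal := fun ε hε => by
    obtain ⟨K, hK0, hK⟩ := QCD.exists_le_MDE hX₀ hX₁ hτ indep₀ ident₀ indepτ₀ hF hϱ tail hυppos hint₀
      hMp hε
    exact ⟨K, hK0, fun h hh => (ENNReal.ofReal_le_iff_le_toReal (hEfin h hh)).1 (hK h hh)⟩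
  have hE₀ : ∀ h, 0 ≤ h → 0 < (QCD.MDE P X₀ X₁ τ F h).toReal := fun h hh => by
    obtain ⟨K, hK0, hK⟩ := hE₂ 1 zero_lt_one
    exact lt_of_lt_of_le (by positivity) (hK h hh)
  have ha : 0 < 1 / m₁ := by positivity
  have hfin : ∀ κ, QCD.optCost P X₀ X₁ τ F κ ≠ ⊤ := fun κ =>
    ne_top_of_le_ne_top (QCD.cost_ne_top (hDfin 0 le_rfl) (hEfin 0 le_rfl)) (QCD.optCost_le_cost le_rfl)
  -- the optimal cost
  have hup : ∀ ε > 0, ∀ᶠ κ in atTop,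
      (QCD.optCost P X₀ X₁ τ F κ).toReal ≤ (1 / m₁ * (1 / υp) + ε) * Real.log κ := fun ε hε => by
    filter_upwards [Real.tendsto_log_atTop.eventually
      (QCD.eventually_exists_cost_le hυppos hD₁ hE₁ hε), eventually_gt_atTop 0] with κ hκ hκ0
    obtain ⟨h, hh, hle⟩ := hκ
    rw [Real.exp_log hκ0, ← QCD.toReal_cost (hDfin h hh) (hEfin h hh) hκ0.le] at hle
    exact (ENNReal.toReal_mono (QCD.cost_ne_top (hDfin h hh) (hEfin h hh))
      (QCD.optCost_le_cost hh)).trans hle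
  have hlow : ∀ ε > 0, ∀ᶠ κ in atTop,
      (1 / m₁ * (1 / υp) - ε) * Real.log κ ≤ (QCD.optCost P X₀ X₁ τ F κ).toReal := fun ε hε => by
    filter_upwards [Real.tendsto_log_atTop.eventually (QCD.eventually_le_cost ha hυppos
      (fun h _ => ENNReal.toReal_nonneg) (fun h _ => ENNReal.toReal_nonneg) hD₂ hE₂ hε),
      eventually_gt_atTop 0] with κ hκ hκ0
    rw [← ENNReal.ofReal_le_iff_le_toReal (hfin κ)]
    refine le_iInf₂ fun h hh => ?_
    rw [ENNReal.ofReal_le_iff_le_toReal (QCD.cost_ne_top (hDfin h hh) (hEfin h hh)),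
      QCD.toReal_cost (hDfin h hh) (hEfin h hh) hκ0.le]
    have := hκ h hh
    rwa [Real.exp_log hκ0] at this
  -- nearly optimal thresholds
  have hnear : ∀ δ : ℝ, 0 < δ → ∀ hstar : ℝ → ℝ,
      (∀ᶠ κ in atTop, hstar κ ∈ QCD.nearOptThresholds P X₀ X₁ τ F δ κ) →
      (fun κ => hstar κ - 1 / υp * Real.log κ) =o[atTop] Real.log := by
    intro δ hδ hstar hopt
    refine QCD.isLittleO_sub_log_of_cost_le ha hυppos (fun h _ => ENNReal.toReal_nonneg)
      (fun h _ => ENNReal.toReal_nonneg) hD₂ hE₂ (hopt.mono fun κ hκ => hκ.1) fun ε hε => ?_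
    filter_upwards [hopt, hup (ε / 2) (half_pos hε), eventually_gt_atTop 0,
      Real.tendsto_log_atTop.eventually (QCD.eventually_le_mul_atTop (half_pos hε) δ)]
      with κ hκ hκup hκ0 hκδ
    rw [← QCD.toReal_cost (hDfin _ hκ.1) (hEfin _ hκ.1) hκ0.le]
    have := ENNReal.toReal_mono (ENNReal.add_ne_top.2 ⟨hfin κ, ENNReal.ofReal_ne_top⟩) hκ.2
    rw [ENNReal.toReal_add (hfin κ) ENNReal.ofReal_ne_top, ENNReal.toReal_ofReal hδ.le] at this
    linarith
  -- The error terms are defined by solving for them: ε₁ = MDD/h - 1/m₁ and ε₂ = -log(MDE)/h - υ₊.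
  -- The formula is then an identity, since MDE > 0.
  refine ⟨⟨_, _, QCD.tendsto_div_sub_of_linear_bounds hD₁ hD₂,
    QCD.tendsto_neg_log_div_sub_of_exp_bounds hE₁ hE₂, fun h κ hh hκ =>
      ⟨QCD.cost_ne_top (hDfin h hh.le) (hEfin h hh.le), ?_⟩⟩, ?_, hnear,
    Eventually.of_forall hfin, ?_⟩
  · rw [QCD.toReal_cost (hDfin h hh.le) (hEfin h hh.le) hκ.le, add_sub_cancel, add_sub_cancel,
      mul_div_cancel₀ _ hh.ne', mul_div_cancel₀ _ hh.ne', neg_neg, Real.exp_log (hE₀ h hh.le)]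
  · exact fun hstar hopt => hnear 1 zero_lt_one hstar
      (hopt.mono fun κ hκ => QCD.optThresholds_subset_nearOptThresholds hκ)
  · refine isLittleO_iff.2 fun ε hε => ?_
    filter_upwards [hup ε hε, hlow ε hε, Real.tendsto_log_atTop.eventually (eventually_gt_atTop 0)]
      with κ h1 h2 h3
    rw [Real.norm_eq_abs, Real.norm_eq_abs, abs_of_pos h3, abs_le]
    constructor <;> linarith
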